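/- Let $\mathrm{Act}$ be a finite, non-empty set of actions. Processes are the terms $p ::= \mathtt 0 \mid a.p \mid p+p$ with $a\in\mathrm{Act}$, with the usual transitions: $a.p\xrightarrow{a}p$, and $p_1+p_2\xrightarrow{a}p'$ whenever $p_1\xrightarrow{a}p'$ or $p_2\xrightarrow{a}p'$. The formulae of $\mathcal L_S$ (the logic of the simulation preorder) are $$\varphi ::= \mathbf{tt}\mid\mathbf{ff}\mid\varphi\wedge\varphi\mid\varphi\vee\varphi\mid\langle a\rangle\varphi ,\qquad a\in\mathrm{Act},$$ where $p\models\langle a\rangle\varphi$ iff $p\xrightarrow{a}q$ for some $q\models\varphi$, and the other operators have their usual meaning. We write $\varphi\models\psi$ if every process that satisfies $\varphi$ satisfies $\psi$. A formula $\varphi\in\mathcal L_S$ is prime if, for all $\varphi_1,\varphi_2\in\mathcal L_S$, $\varphi\models\varphi_1\vee\varphi_2$ implies $\varphi\models\varphi_1$ or $\varphi\models\varphi_2$. (1) Whether a given $\varphi\in\mathcal L_S$ is prime can be decided in polynomial time, namely in time $O(n^3)$, where $n=|\varphi|$ is the number of symbols of $\varphi$. Precisely: there are a constant $c$ and a single random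 access machine program (finitely many instructions: load a constant, addition, truncated subtraction, indirect load, indirect store, read an input letter, jump on zero) which, for every finite non-empty $\mathrm{Act}$ whose actions are named by distinct natural numbers and every $\varphi\in\mathcal L_S$ over $\mathrm{Act}$, given as the sequence of its symbols in prefix notation, halts after at most $c\,n^3$ steps with the correct answer, while all numbers in its memory stay at most $c\,(n^3+m)$, where $m$ is the largest number in the input sequence (so that the numbers have $O(\log (n+m))$ bits). (2) Let $\bigvee_{i=1}^k\varphi_i$ be the disjunctive normal form of $\varphi\in\mathcal L_S$, obtained by distributing $\wedge$ and $\langle a\rangle$ over $\vee$. Then $\varphi$ is prime if and only if for all $1\le i,j\le k$ there is $1\le m\le k$ with $\varphi_i\models\varphi_m$ and $\varphi_j\models\varphi_m$. -/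

import Mathlib

namespace SimLogic

universe u

/-- Finite, loop-free processes over the action set `Act`, given as terms of the CCS fragment
`p ::= 0 | a.p | p + p`. -/
inductive Proc (Act : Type u) : Type u
  | nil : Proc Act
  | pre : Act → Proc Act → Proc Act
  | plus : Proc Act → Proc Act → Proc Act

/-- The labelled transitions `p --a--> q` between processes. -/
inductive Proc.Step {Act : Type u} : Proc Act → Act → Proc Act → Prop
  | pre (a : Act) (p : Proc Act) : Proc.Step (Proc.pre a p) a p
  | plusLeft {p q r : Proc Act} {a : Act} : Proc.Step p a r → Proc.Step (Proc.plus p q) a r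
  | plusRight {p q r : Proc Act} {a : Act} : Proc.Step q a r → Proc.Step (Proc.plus p q) a r

/-- The logic `L_S`: `φ ::= tt | ff | φ ∧ φ | φ ∨ φ | ⟨a⟩φ`. -/
inductive Formula (Act : Type u) : Type u
  | tt : Formula Act
  | ff : Formula Act
  | and : Formula Act → Formula Act → Formula Act
  | or : Formula Act → Formula Act → Formula Act
  | dia : Act → Formula Act → Formula Act

namespace Formula

variable {Act : Type u}

/-- The satisfaction relation `p ⊨ φ`. -/
def Sat : Proc Act → Formula Act → Prop
  | _, tt => True
  | _, ff => False
  | p, and φ ψ => Sat p φ ∧ Sat p ψ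
  | p, or φ ψ => Sat p φ ∨ Sat p ψ
  | p, dia a φ => ∃ q, Proc.Step p a q ∧ Sat q φ

/-- `φ ⊨ ψ`: every process that satisfies `φ` satisfies `ψ`. -/
def Entails (φ ψ : Formula Act) : Prop :=
  ∀ p : Proc Act, Sat p φ → Sat p ψ

/-- `φ` is prime (in `L_S`). -/
def Prime (φ : Formula Act) : Prop :=
  ∀ φ₁ φ₂ : Formula Act, Entails φ (or φ₁ φ₂) → Entails φ φ₁ ∨ Entails φ φ₂

/-- The disjuncts of the disjunctive normal form of a formula, obtained by distributing
conjunctions and diamonds over disjunctions. -/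
def dnf : Formula Act → List (Formula Act)
  | tt => [tt]
  | ff => [ff]
  | and φ ψ => φ.dnf.flatMap fun α => ψ.dnf.map fun β => and α β
  | or φ ψ => φ.dnf ++ ψ.dnf
  | dia a φ => φ.dnf.map (dia a)

/-- The number of symbols of a formula, each `⟨a⟩` being one symbol. -/
def size : Formula Act → ℕ
  | tt => 1
  | ff => 1
  | and φ ψ => 1 + φ.size + ψ.size
  | or φ ψ => 1 + φ.size + ψ.size
  | dia _ φ => 1 + φ.size

/-- A formula as a word in prefix (Polish) notation. The letters `tt`, `ff`, `∧`, `∨` are coded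
by `1`, `2`, `3`, `4`, and `⟨a⟩` by `5 + name a`, where `name` numbers the actions. -/
def code (name : Act → ℕ) : Formula Act → List ℕ
  | tt => [1]
  | ff => [2]
  | and φ ψ => 3 :: (φ.code name ++ ψ.code name)
  | or φ ψ => 4 :: (φ.code name ++ ψ.code name)
  | dia a φ => (5 + name a) :: φ.code name

end Formula

end SimLogic

/-! Random access machines: a finite program of instructions, a read-only input, and a memory of
cells `M[0], M[1], …` that hold natural numbers and are initially `0`. -/
namespace RAM

/-- The instructions. In each of them, the arguments are fixed natural numbers. -/
inductive Instr : Type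
  /-- `M[d] := c` -/
  | const (d c : ℕ) : Instr
  /-- `M[d] := M[a] + M[b]` -/
  | add (d a b : ℕ) : Instr
  /-- `M[d] := max (M[a] - M[b]) 0` -/
  | sub (d a b : ℕ) : Instr
  /-- `M[d] := M[M[a]]` -/
  | load (d a : ℕ) : Instr
  /-- `M[M[a]] := M[b]` -/
  | store (a b : ℕ) : Instr
  /-- `M[d] :=` the input letter at position `M[a]` (from `0`), or `0` past the end of the input -/
  | read (d a : ℕ) : Instr
  /-- if `M[a] = 0`, continue at instruction number `l` -/
  | jzero (a l : ℕ) : Instr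

/-- A program; its instructions are numbered from `0`. -/
abbrev Program : Type := List Instr

/-- A configuration: the number of the next instruction, and the memory. -/
structure Config : Type where
  pc : ℕ
  mem : ℕ → ℕ

/-- Execute one instruction. -/
def Instr.exec (x : List ℕ) (s : Config) : Instr → Config
  | .const d c => ⟨s.pc + 1, Function.update s.mem d c⟩
  | .add d a b => ⟨s.pc + 1, Function.update s.mem d (s.mem a + s.mem b)⟩
  | .sub d a b => ⟨s.pc + 1, Function.update s.mem d (s.mem a - s.mem b)⟩
  | .load d a => ⟨s.pc + 1, Function.update s.mem d (s.mem (s.mem a))⟩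
  | .store a b => ⟨s.pc + 1, Function.update s.mem (s.mem a) (s.mem b)⟩
  | .read d a => ⟨s.pc + 1, Function.update s.mem d (x.getD (s.mem a) 0)⟩
  | .jzero a l => ⟨if s.mem a = 0 then l else s.pc + 1, s.mem⟩

/-- One step of the program `P` on input `x`. The machine has halted, and its configuration no
longer changes, when the number of the next instruction lies outside the program. -/
def step (P : Program) (x : List ℕ) (s : Config) : Config :=
  match P[s.pc]? with
  | some i => i.exec x s
  | none => s

/-- The configuration after `t` steps on input `x`. -/
def run (P : Program) (x : List ℕ) (t : ℕ) : Config :=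
  (step P x)^[t] ⟨0, fun _ => 0⟩

/-- On input `x`, the program `P` halts after at most `T` steps with the correct answer to the
question whether `A` holds (`M[0] = 1` for yes and `M[0] = 0` for no), and no memory cell ever holds
a number greater than `W`. -/
def DecidesWithin (P : Program) (x : List ℕ) (A : Prop) (T W : ℕ) : Prop :=
  ∃ t ≤ T, P.length ≤ (run P x t).pc ∧
    ((A ∧ (run P x t).mem 0 = 1) ∨ (¬ A ∧ (run P x t).mem 0 = 0)) ∧
    ∀ s ≤ t, ∀ i, (run P x s).mem i ≤ W

end RAM

namespace SimLogic

/-! ### Satisfaction in sums and unsatisfiability -/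

namespace Formula

variable {Act : Type*}

/-! The logic has no negation, so satisfaction survives adding a summand. Consequently a satisfiable
disjunction-free formula has a least model, its characteristic process: whatever that process
satisfies, every model satisfies (`IsConj.sat_of_sat_charProc`). Testing an entailment at this
process shows that disjunction-free formulas are prime. Hence `φ` is prime iff it entails one of the
disjuncts of its normal form (`prime_iff_exists_mem_dnf`), and, these being finitely many, iff they
are directed under entailment (`prime_iff_directed`). This is part (2).

The normal form may be exponentially long, so the algorithm works with a rule system `Der x y z` on
subformulas, which lies between two conditions. If `x` and `y` both entail a single disjunct of `z`,
then `Der x y z` (`Der.of_mem_dnf`). If `Der x y z`, then any satisfiable disjuncts of `x` and of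
`y` have a common upper bound among the disjuncts of `z`, possibly a different one for each pair
(`Der.exists_mem_dnf`). For `x = y = z = φ` the outer conditions both amount to primality, so `φ` is
prime iff `Der φ φ φ`.

There are `n ^ 3` triples of subformula occurrences, and by `der_iff` the truth at one of them
depends on boundedly many others, which involve later positions of the prefix word. A table filled
from the last triple to the first therefore costs constant time per entry. The program is written in
a small while language compiled to the machine; the judgement `Does` tracks correctness, running
time and size of numbers together. -/

theorem Sat.plus_left {p : Proc Act} (q : Proc Act) {φ : Formula Act} (h : Sat p φ) :
    Sat (p.plus q) φ := by
  induction φ with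
  | tt => trivial
  | ff => exact h
  | and φ ψ ihφ ihψ => exact ⟨ihφ h.1, ihψ h.2⟩
  | or φ ψ ihφ ihψ => exact h.imp ihφ ihψ
  | dia a φ ih =>
    obtain ⟨r, hr, hs⟩ := h
    exact ⟨r, hr.plusLeft, hs⟩

theorem Sat.plus_right {q : Proc Act} (p : Proc Act) {φ : Formula Act} (h : Sat q φ) :
    Sat (p.plus q) φ := by
  induction φ with
  | tt => trivial
  | ff => exact h
  | and φ ψ ihφ ihψ => exact ⟨ihφ h.1, ihψ h.2⟩
  | or φ ψ ihφ ihψ => exact h.imp ihφ ihψ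
  | dia a φ ih =>
    obtain ⟨r, hr, hs⟩ := h
    exact ⟨r, hr.plusRight, hs⟩

theorem sat_pre_dia {a b : Act} {p : Proc Act} {φ : Formula Act} :
    Sat (Proc.pre b p) (dia a φ) ↔ b = a ∧ Sat p φ := by
  constructor
  · rintro ⟨q, hq, hs⟩
    cases hq
    exact ⟨rfl, hs⟩
  · rintro ⟨rfl, hs⟩
    exact ⟨p, .pre _ _, hs⟩

theorem sat_plus_dia {a : Act} {p q : Proc Act} {φ : Formula Act} :
    Sat (p.plus q) (dia a φ) ↔ Sat p (dia a φ) ∨ Sat q (dia a φ) := by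
  constructor
  · rintro ⟨r, hr, hs⟩
    cases hr with
    | plusLeft h => exact .inl ⟨r, h, hs⟩
    | plusRight h => exact .inr ⟨r, h, hs⟩
  · rintro (h | h)
    · exact h.plus_left q
    · exact h.plus_right p

theorem not_sat_nil_dia {a : Act} {φ : Formula Act} : ¬ Sat Proc.nil (dia a φ) := by
  rintro ⟨q, hq, -⟩
  cases hq

/-- A formula without models. -/
def Unsat (φ : Formula Act) : Prop := ∀ p, ¬ Sat p φ

theorem not_unsat_tt : ¬ Unsat (tt : Formula Act) := fun h => h .nil trivial

theorem unsat_ff : Unsat (ff : Formula Act) := fun _ h => h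

/-- Models of the two conjuncts combine: their sum satisfies both. So a conjunction is unsatisfiable
only through one conjunct, and unsatisfiability is computable bottom-up. -/
theorem unsat_and {φ ψ : Formula Act} : Unsat (and φ ψ) ↔ Unsat φ ∨ Unsat ψ := by
  constructor
  · intro h
    by_contra! hc
    simp only [Unsat, not_forall, not_not] at hc
    obtain ⟨⟨p, hp⟩, q, hq⟩ := hc
    exact h (p.plus q) ⟨hp.plus_left q, hq.plus_right p⟩
  · rintro (h | h) p hp
    · exact h p hp.1
    · exact h p hp.2

theorem unsat_or {φ ψ : Formula Act} : Unsat (or φ ψ) ↔ Unsat φ ∧ Unsat ψ :=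
  ⟨fun h => ⟨fun p hp => h p (.inl hp), fun p hp => h p (.inr hp)⟩,
    fun h p hp => hp.elim (h.1 p) (h.2 p)⟩

theorem unsat_dia {a : Act} {φ : Formula Act} : Unsat (dia a φ) ↔ Unsat φ :=
  ⟨fun h p hp => h (Proc.pre a p) ⟨p, .pre _ _, hp⟩, fun h _ ⟨q, _, hq⟩ => h q hq⟩

/-! ### Disjunctive normal forms -/

theorem sat_iff_exists_mem_dnf {φ : Formula Act} {p : Proc Act} :
    Sat p φ ↔ ∃ α ∈ φ.dnf, Sat p α := by
  induction φ generalizing p with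
  | tt => simp [dnf]
  | ff => simp [dnf]
  | and φ ψ ihφ ihψ =>
    simp only [Sat, dnf, List.mem_flatMap, List.mem_map]
    rw [ihφ, ihψ]
    constructor
    · rintro ⟨⟨α, hα, h⟩, β, hβ, h'⟩
      exact ⟨_, ⟨α, hα, β, hβ, rfl⟩, h, h'⟩
    · rintro ⟨_, ⟨α, hα, β, hβ, rfl⟩, h, h'⟩
      exact ⟨⟨α, hα, h⟩, β, hβ, h'⟩
  | or φ ψ ihφ ihψ =>
    simp only [Sat, dnf, List.mem_append]
    rw [ihφ, ihψ]
    constructor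
    · rintro (⟨α, hα, h⟩ | ⟨α, hα, h⟩)
      · exact ⟨α, .inl hα, h⟩
      · exact ⟨α, .inr hα, h⟩
    · rintro ⟨α, hα | hα, h⟩
      · exact .inl ⟨α, hα, h⟩
      · exact .inr ⟨α, hα, h⟩
  | dia a φ ih =>
    simp only [Sat, dnf, List.mem_map]
    constructor
    · rintro ⟨q, hq, hs⟩
      obtain ⟨α, hα, h⟩ := ih.1 hs
      exact ⟨_, ⟨α, hα, rfl⟩, q, hq, h⟩
    · rintro ⟨_, ⟨α, hα, rfl⟩, q, hq, h⟩
      exact ⟨q, hq, ih.2 ⟨α, hα, h⟩⟩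

theorem entails_of_mem_dnf {φ α : Formula Act} (h : α ∈ φ.dnf) : α.Entails φ :=
  fun _ hp => sat_iff_exists_mem_dnf.2 ⟨α, h, hp⟩

theorem dnf_ne_nil (φ : Formula Act) : φ.dnf ≠ [] := by
  induction φ with
  | tt => simp [dnf]
  | ff => simp [dnf]
  | and φ ψ ihφ ihψ =>
    obtain ⟨α, hα⟩ := List.exists_mem_of_ne_nil _ ihφ
    simp only [dnf, ne_eq, List.flatMap_eq_nil_iff, List.map_eq_nil_iff, not_forall]
    exact ⟨α, hα, ihψ⟩
  | or φ ψ ihφ ihψ => simp [dnf, ihφ]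
  | dia a φ ih => simpa [dnf] using ih

/-! ### Characteristic processes of disjunction-free formulas -/

/-- Formulas without disjunctions. -/
def IsConj : Formula Act → Prop
  | tt => True
  | ff => True
  | and φ ψ => φ.IsConj ∧ ψ.IsConj
  | or _ _ => False
  | dia _ φ => φ.IsConj

theorem isConj_of_mem_dnf {φ α : Formula Act} (h : α ∈ φ.dnf) : α.IsConj := by
  induction φ generalizing α with
  | tt => simp only [dnf, List.mem_singleton] at h; subst h; trivial
  | ff => simp only [dnf, List.mem_singleton] at h; subst h; trivial
  | and φ ψ ihφ ihψ =>
    simp only [dnf, List.mem_flatMap, List.mem_map] at h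
    obtain ⟨α, hα, β, hβ, rfl⟩ := h
    exact ⟨ihφ hα, ihψ hβ⟩
  | or φ ψ ihφ ihψ => exact (List.mem_append.1 h).elim ihφ ihψ
  | dia a φ ih =>
    simp only [dnf, List.mem_map] at h
    obtain ⟨α, hα, rfl⟩ := h
    have hα' : α.IsConj := ih hα
    exact hα'

/-- The characteristic process of a satisfiable disjunction-free formula. -/
def charProc : Formula Act → Proc Act
  | tt => .nil
  | ff => .nil
  | and φ ψ => .plus φ.charProc ψ.charProc
  | or _ _ => .nil
  | dia a φ => .pre a φ.charProc

theorem IsConj.sat_charProc {α : Formula Act} (hα : α.IsConj) {q : Proc Act} (h : Sat q α) :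
    Sat α.charProc α := by
  induction α generalizing q with
  | tt => trivial
  | ff => exact h
  | and φ ψ ihφ ihψ => exact ⟨(ihφ hα.1 h.1).plus_left _, (ihψ hα.2 h.2).plus_right _⟩
  | or φ ψ => exact hα.elim
  | dia a φ ih =>
    obtain ⟨r, -, hr⟩ := h
    exact ⟨_, .pre _ _, ih hα hr⟩

/-- The characteristic process is the least model. Only a diamond `ψ` needs thought: a step of a sum
comes from one summand, and a prefix has just one step, which any model of `dia a φ` can match. -/
theorem IsConj.sat_of_sat_charProc {α : Formula Act} (hα : α.IsConj) {q : Proc Act}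
    (h : Sat q α) {ψ : Formula Act} (hψ : Sat α.charProc ψ) : Sat q ψ := by
  induction α generalizing q ψ with
  | tt =>
    induction ψ with
    | tt => trivial
    | ff => exact hψ
    | and _ _ ih₁ ih₂ => exact ⟨ih₁ hψ.1, ih₂ hψ.2⟩
    | or _ _ ih₁ ih₂ => exact hψ.imp ih₁ ih₂
    | dia a ψ => exact (not_sat_nil_dia hψ).elim
  | ff => exact h.elim
  | and φ φ' ihφ ihφ' =>
    induction ψ with
    | tt => trivial
    | ff => exact hψ
    | and _ _ ih₁ ih₂ => exact ⟨ih₁ hψ.1, ih₂ hψ.2⟩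
    | or _ _ ih₁ ih₂ => exact hψ.imp ih₁ ih₂
    | dia a ψ => exact (sat_plus_dia.1 hψ).elim (ihφ hα.1 h.1) (ihφ' hα.2 h.2)
  | or φ ψ => exact hα.elim
  | dia a φ ih =>
    induction ψ with
    | tt => trivial
    | ff => exact hψ
    | and _ _ ih₁ ih₂ => exact ⟨ih₁ hψ.1, ih₂ hψ.2⟩
    | or _ _ ih₁ ih₂ => exact hψ.imp ih₁ ih₂
    | dia b ψ =>
      obtain ⟨rfl, hs⟩ := sat_pre_dia.1 hψ
      obtain ⟨r, hr, hr'⟩ := h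
      exact ⟨r, hr, ih hα hr' hs⟩

theorem IsConj.prime {α : Formula Act} (hα : α.IsConj) : α.Prime := by
  intro φ₁ φ₂ h
  by_cases hu : Unsat α
  · exact .inl fun p hp => (hu p hp).elim
  · simp only [Unsat, not_forall, not_not] at hu
    obtain ⟨q, hq⟩ := hu
    exact (h _ (hα.sat_charProc hq)).imp (fun h _ hp => hα.sat_of_sat_charProc hp h)
      (fun h _ hp => hα.sat_of_sat_charProc hp h)

/-! ### Primality in terms of the disjunctive normal form -/

/-- Iterates binary primality along a list; the covering hypothesis is semantic, so the disjunction
of the tail is only built when needed. -/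
theorem Prime.exists_entails_of_list {φ : Formula Act} (hφ : φ.Prime) :
    ∀ l : List (Formula Act), l ≠ [] → (∀ p, Sat p φ → ∃ α ∈ l, Sat p α) →
      ∃ α ∈ l, φ.Entails α
  | [], h, _ => (h rfl).elim
  | [α], _, h => ⟨α, by simp, fun p hp => by simpa using h p hp⟩
  | α :: β :: l, _, h => by
    -- the disjunction of the tail of the list
    obtain ⟨ψ, hψ⟩ : ∃ ψ : Formula Act, ∀ p, Sat p ψ ↔ ∃ γ ∈ β :: l, Sat p γ := by
      generalize β :: l = l'
      induction l' with
      | nil => exact ⟨ff, by simp [Sat]⟩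
      | cons γ l' ih =>
        obtain ⟨ψ, hψ⟩ := ih
        exact ⟨or γ ψ, fun p => by simp [Sat, hψ]⟩
    have hor : φ.Entails (or α ψ) := fun p hp => by
      obtain ⟨γ, hγ, hs⟩ := h p hp
      rcases List.mem_cons.1 hγ with rfl | hγ
      · exact .inl hs
      · exact .inr ((hψ p).2 ⟨γ, hγ, hs⟩)
    rcases hφ _ _ hor with h' | h'
    · exact ⟨α, by simp, h'⟩
    · obtain ⟨γ, hγ, hs⟩ :=
        hφ.exists_entails_of_list (β :: l) (by simp) fun p hp => (hψ p).1 (h' p hp)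
      exact ⟨γ, List.mem_cons_of_mem _ hγ, hs⟩

/-- A disjunct entailed by `φ` also entails `φ`, so `φ` is equivalent to a disjunction-free formula
and inherits its primality. -/
theorem prime_iff_exists_mem_dnf {φ : Formula Act} :
    φ.Prime ↔ ∃ γ ∈ φ.dnf, φ.Entails γ := by
  constructor
  · intro h
    exact h.exists_entails_of_list _ φ.dnf_ne_nil fun p hp => sat_iff_exists_mem_dnf.1 hp
  · rintro ⟨γ, hγ, h⟩ φ₁ φ₂ h'
    exact ((isConj_of_mem_dnf hγ).prime φ₁ φ₂ fun p hp => h' p (entails_of_mem_dnf hγ p hp)).imp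
      (fun hc p hp => hc p (h p hp)) (fun hc p hp => hc p (h p hp))

/-- Finite subsets of a directed preorder are bounded. `S` stays fixed while `l` grows, so that the
induction keeps directedness. -/
theorem exists_upper_bound_of_directed {S l : List (Formula Act)} (hS : S ≠ [])
    (hdir : ∀ α ∈ S, ∀ β ∈ S, ∃ γ ∈ S, α.Entails γ ∧ β.Entails γ) (hl : ∀ α ∈ l, α ∈ S) :
    ∃ γ ∈ S, ∀ α ∈ l, α.Entails γ := by
  induction l with
  | nil =>
    obtain ⟨γ, hγ⟩ := List.exists_mem_of_ne_nil _ hS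
    exact ⟨γ, hγ, by simp⟩
  | cons α l ih =>
    obtain ⟨γ, hγ, h⟩ := ih fun β hβ => hl β (List.mem_cons_of_mem _ hβ)
    obtain ⟨δ, hδ, h₁, h₂⟩ := hdir α (hl α (by simp)) γ hγ
    refine ⟨δ, hδ, fun β hβ => ?_⟩
    rcases List.mem_cons.1 hβ with rfl | hβ
    · exact h₁
    · exact fun p hp => h₂ p (h β hβ p hp)

theorem prime_iff_directed {φ : Formula Act} :
    φ.Prime ↔ ∀ α ∈ φ.dnf, ∀ β ∈ φ.dnf, ∃ γ ∈ φ.dnf, α.Entails γ ∧ β.Entails γ := by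
  rw [prime_iff_exists_mem_dnf]
  constructor
  · rintro ⟨γ, hγ, h⟩ α hα β hβ
    exact ⟨γ, hγ, fun p hp => h p (entails_of_mem_dnf hα p hp),
      fun p hp => h p (entails_of_mem_dnf hβ p hp)⟩
  · intro h
    obtain ⟨γ, hγ, h'⟩ := exists_upper_bound_of_directed φ.dnf_ne_nil h fun _ h => h
    refine ⟨γ, hγ, fun p hp => ?_⟩
    obtain ⟨α, hα, hs⟩ := sat_iff_exists_mem_dnf.1 hp
    exact h' α hα p hs

/-! ### A syntactic criterion for primality -/

/-- Derivability of the triple `x, y ⇒ z`. -/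
inductive Der : Formula Act → Formula Act → Formula Act → Prop
  | unsatL {x y z} : Unsat x → Der x y z
  | unsatR {x y z} : Unsat y → Der x y z
  | tt {x y} : Der x y tt
  | and {x y z₁ z₂} : Der x y z₁ → Der x y z₂ → Der x y (and z₁ z₂)
  | or₁ {x y z₁ z₂} : Der x y z₁ → Der x y (or z₁ z₂)
  | or₂ {x y z₁ z₂} : Der x y z₂ → Der x y (or z₁ z₂)
  | andL₁ {x₁ x₂ y z} : Der x₁ y z → Der (and x₁ x₂) y z
  | andL₂ {x₁ x₂ y z} : Der x₂ y z → Der (and x₁ x₂) y z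
  | orL {x₁ x₂ y z} : Der x₁ y z → Der x₂ y z → Der (or x₁ x₂) y z
  | andR₁ {x y₁ y₂ z} : Der x y₁ z → Der x (Formula.and y₁ y₂) z
  | andR₂ {x y₁ y₂ z} : Der x y₂ z → Der x (Formula.and y₁ y₂) z
  | orR {x y₁ y₂ z} : Der x y₁ z → Der x y₂ z → Der x (Formula.or y₁ y₂) z
  | dia {a x y z} : Der x y z → Der (dia a x) (dia a y) (dia a z)

/-- Soundness of the rules. `γ` must be allowed to depend on `α` and `β`, since the premises of
`orL` and `orR` may lead to different choices. Unsatisfiable disjuncts are excluded because of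
`unsatL` and `unsatR`: when `x` has no model, nothing is known about `β`. -/
theorem Der.exists_mem_dnf {x y z : Formula Act} (h : Der x y z) :
    ∀ α ∈ x.dnf, ∀ β ∈ y.dnf, ¬ Unsat α → ¬ Unsat β →
      ∃ γ ∈ z.dnf, α.Entails γ ∧ β.Entails γ := by
  induction h with
  | unsatL h =>
    exact fun α hα _ _ hs => (hs fun p hp => h p (entails_of_mem_dnf hα p hp)).elim
  | unsatR h =>
    exact fun _ _ β hβ _ hs => (hs fun p hp => h p (entails_of_mem_dnf hβ p hp)).elim
  | tt => exact fun _ _ _ _ _ _ => ⟨_, List.mem_singleton.2 rfl, fun _ _ => trivial,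
      fun _ _ => trivial⟩
  | and _ _ ih₁ ih₂ =>
    intro α hα β hβ sα sβ
    obtain ⟨γ, hγ, h₁, h₂⟩ := ih₁ α hα β hβ sα sβ
    obtain ⟨γ', hγ', h₁', h₂'⟩ := ih₂ α hα β hβ sα sβ
    exact ⟨_, List.mem_flatMap.2 ⟨γ, hγ, List.mem_map.2 ⟨γ', hγ', rfl⟩⟩,
      fun p hp => ⟨h₁ p hp, h₁' p hp⟩, fun p hp => ⟨h₂ p hp, h₂' p hp⟩⟩
  | or₁ _ ih =>
    intro α hα β hβ sα sβ
    obtain ⟨γ, hγ, h⟩ := ih α hα β hβ sα sβ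
    exact ⟨γ, List.mem_append_left _ hγ, h⟩
  | or₂ _ ih =>
    intro α hα β hβ sα sβ
    obtain ⟨γ, hγ, h⟩ := ih α hα β hβ sα sβ
    exact ⟨γ, List.mem_append_right _ hγ, h⟩
  | andL₁ _ ih =>
    intro α hα β hβ sα sβ
    simp only [dnf, List.mem_flatMap, List.mem_map] at hα
    obtain ⟨α, hα, α', hα', rfl⟩ := hα
    rw [unsat_and, not_or] at sα
    obtain ⟨γ, hγ, h₁, h₂⟩ := ih α hα β hβ sα.1 sβ
    exact ⟨γ, hγ, fun p hp => h₁ p hp.1, h₂⟩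
  | andL₂ _ ih =>
    intro α hα β hβ sα sβ
    simp only [dnf, List.mem_flatMap, List.mem_map] at hα
    obtain ⟨α, hα, α', hα', rfl⟩ := hα
    rw [unsat_and, not_or] at sα
    obtain ⟨γ, hγ, h₁, h₂⟩ := ih α' hα' β hβ sα.2 sβ
    exact ⟨γ, hγ, fun p hp => h₁ p hp.2, h₂⟩
  | orL _ _ ih₁ ih₂ =>
    exact fun α hα => (List.mem_append.1 hα).elim (ih₁ α) (ih₂ α)
  | andR₁ _ ih =>
    intro α hα β hβ sα sβ
    simp only [dnf, List.mem_flatMap, List.mem_map] at hβ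
    obtain ⟨β, hβ, β', hβ', rfl⟩ := hβ
    rw [unsat_and, not_or] at sβ
    obtain ⟨γ, hγ, h₁, h₂⟩ := ih α hα β hβ sα sβ.1
    exact ⟨γ, hγ, h₁, fun p hp => h₂ p hp.1⟩
  | andR₂ _ ih =>
    intro α hα β hβ sα sβ
    simp only [dnf, List.mem_flatMap, List.mem_map] at hβ
    obtain ⟨β, hβ, β', hβ', rfl⟩ := hβ
    rw [unsat_and, not_or] at sβ
    obtain ⟨γ, hγ, h₁, h₂⟩ := ih α hα β' hβ' sα sβ.2
    exact ⟨γ, hγ, h₁, fun p hp => h₂ p hp.2⟩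
  | orR _ _ ih₁ ih₂ =>
    exact fun α hα β hβ => (List.mem_append.1 hβ).elim (ih₁ α hα β) (ih₂ α hα β)
  | dia _ ih =>
    intro α hα β hβ sα sβ
    simp only [dnf, List.mem_map] at hα hβ
    obtain ⟨α, hα, rfl⟩ := hα
    obtain ⟨β, hβ, rfl⟩ := hβ
    rw [unsat_dia] at sα sβ
    obtain ⟨γ, hγ, h₁, h₂⟩ := ih α hα β hβ sα sβ
    exact ⟨_, List.mem_map.2 ⟨γ, hγ, rfl⟩, fun p ⟨q, hq, hs⟩ => ⟨q, hq, h₁ q hs⟩,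
      fun p ⟨q, hq, hs⟩ => ⟨q, hq, h₂ q hs⟩⟩

theorem not_tt_entails_dia {a : Act} {γ : Formula Act} : ¬ Entails tt (dia a γ) :=
  fun h => not_sat_nil_dia (h .nil trivial)

/-- The sum of two counterexamples, one for each conjunct, would be a counterexample for the
conjunction. -/
theorem Entails.of_and_dia {a : Act} {x₁ x₂ γ : Formula Act}
    (h : Entails (and x₁ x₂) (dia a γ)) : x₁.Entails (dia a γ) ∨ x₂.Entails (dia a γ) := by
  by_contra! hc
  simp only [Entails, not_forall] at hc
  obtain ⟨⟨p, hp, hp'⟩, q, hq, hq'⟩ := hc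
  exact (sat_plus_dia.1 (h (p.plus q) ⟨hp.plus_left q, hq.plus_right p⟩)).elim hp' hq'

theorem Entails.of_dia_dia {a b : Act} {x γ : Formula Act}
    (h : Entails (dia b x) (dia a γ)) : Unsat x ∨ b = a ∧ x.Entails γ := by
  by_cases hu : Unsat x
  · exact .inl hu
  · simp only [Unsat, not_forall, not_not] at hu
    obtain ⟨q, hq⟩ := hu
    have key : ∀ p, Sat p x → b = a ∧ Sat p γ := fun p hp =>
      sat_pre_dia.1 (h (Proc.pre b p) (sat_pre_dia.2 ⟨rfl, hp⟩))
    exact .inr ⟨(key q hq).1, fun p hp => (key p hp).2⟩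

/-- Completeness of the rules, with one `γ` above both sides. First `z` is taken apart along `γ`;
once `z` is a diamond, `x` and then `y` are taken apart until they are diamonds too, or
unsatisfiable. -/
theorem Der.of_mem_dnf {x y z γ : Formula Act} (hγ : γ ∈ z.dnf) (hx : x.Entails γ)
    (hy : y.Entails γ) : Der x y z := by
  induction z generalizing x y γ with
  | tt => exact .tt
  | ff =>
    simp only [dnf, List.mem_singleton] at hγ
    subst hγ
    -- Entailing `ff` unfolds to having no model.
    exact .unsatL hx
  | and z₁ z₂ ih₁ ih₂ =>
    simp only [dnf, List.mem_flatMap, List.mem_map] at hγ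
    obtain ⟨γ₁, hγ₁, γ₂, hγ₂, rfl⟩ := hγ
    exact .and (ih₁ hγ₁ (fun p hp => (hx p hp).1) fun p hp => (hy p hp).1)
      (ih₂ hγ₂ (fun p hp => (hx p hp).2) fun p hp => (hy p hp).2)
  | or z₁ z₂ ih₁ ih₂ =>
    rcases List.mem_append.1 hγ with hγ | hγ
    · exact .or₁ (ih₁ hγ hx hy)
    · exact .or₂ (ih₂ hγ hx hy)
  | dia a z ih =>
    simp only [dnf, List.mem_map] at hγ
    obtain ⟨γ, hγ, rfl⟩ := hγ
    induction x with
    | tt => exact (not_tt_entails_dia hx).elim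
    | ff => exact .unsatL unsat_ff
    | and x₁ x₂ ih₁ ih₂ => exact hx.of_and_dia.elim (fun h => .andL₁ (ih₁ h)) fun h => .andL₂ (ih₂ h)
    | or x₁ x₂ ih₁ ih₂ =>
      exact .orL (ih₁ fun p hp => hx p (.inl hp)) (ih₂ fun p hp => hx p (.inr hp))
    | dia b x ihx =>
      -- This hypothesis mentions `y` and would burden the induction on `y`.
      clear ihx
      induction y with
      | tt => exact (not_tt_entails_dia hy).elim
      | ff => exact .unsatR unsat_ff
      | and y₁ y₂ ih₁ ih₂ =>
        exact hy.of_and_dia.elim (fun h => .andR₁ (ih₁ h)) fun h => .andR₂ (ih₂ h)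
      | or y₁ y₂ ih₁ ih₂ =>
        exact .orR (ih₁ fun p hp => hy p (.inl hp)) (ih₂ fun p hp => hy p (.inr hp))
      | dia c y =>
        rcases hx.of_dia_dia with hu | ⟨rfl, hx'⟩
        · exact .unsatL (unsat_dia.2 hu)
        rcases hy.of_dia_dia with hu | ⟨rfl, hy'⟩
        · exact .unsatR (unsat_dia.2 hu)
        exact .dia (ih hγ hx' hy')

/-- Completeness applies to the uniform bound that primality gives; soundness returns directedness.
Unsatisfiable disjuncts lie below everything, so their exclusion from soundness does no harm. -/
theorem prime_iff_der {φ : Formula Act} : φ.Prime ↔ Der φ φ φ := by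
  constructor
  · intro h
    obtain ⟨γ, hγ, h⟩ := prime_iff_exists_mem_dnf.1 h
    exact .of_mem_dnf hγ h h
  · refine fun h => prime_iff_directed.2 fun α hα β hβ => ?_
    by_cases sα : Unsat α
    · exact ⟨β, hβ, fun p hp => (sα p hp).elim, fun _ hp => hp⟩
    by_cases sβ : Unsat β
    · exact ⟨α, hα, fun _ hp => hp, fun p hp => (sβ p hp).elim⟩
    exact h.exists_mem_dnf α hα β hβ sα sβ

/-! ### One-step unfoldings for the dynamic program -/

/-- `f` holds of one conjunct, or of both disjuncts. -/
def Left (f : Formula Act → Prop) : Formula Act → Prop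
  | and a b => f a ∨ f b
  | or a b => f a ∧ f b
  | _ => False

/-- `f` holds of both conjuncts, or of one disjunct. -/
def Right (f : Formula Act → Prop) : Formula Act → Prop
  | and a b => f a ∧ f b
  | or a b => f a ∨ f b
  | _ => False

theorem unsat_iff {x : Formula Act} :
    Unsat x ↔ x = ff ∨ Left Unsat x ∨ ∃ a x', x = dia a x' ∧ Unsat x' := by
  cases x with
  | tt => simp [Left, not_unsat_tt]
  | ff => simp [unsat_ff]
  | and x y => simp [Left, unsat_and]
  | or x y => simp [Left, unsat_or]
  | dia a x => simp [Left, unsat_dia]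

/-- The recurrence for the table: a call replaces one component by an argument of its connective, or
all three by the bodies of diamonds. The bracketing is that of `derStep`. -/
theorem der_iff {x y z : Formula Act} :
    Der x y z ↔ (Unsat x ∨ Unsat y) ∨ (z = tt ∨ Right (Der x y) z) ∨
      (Left (fun x => Der x y z) x ∨ Left (fun y => Der x y z) y) ∨
      ∃ a x' y' z', x = dia a x' ∧ y = dia a y' ∧ z = dia a z' ∧ Der x' y' z' := by
  constructor
  · intro h
    cases h with
    | unsatL h => exact .inl (.inl h)
    | unsatR h => exact .inl (.inr h)
    | tt => exact .inr (.inl (.inl rfl))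
    | and h₁ h₂ => exact .inr (.inl (.inr ⟨h₁, h₂⟩))
    | or₁ h => exact .inr (.inl (.inr (.inl h)))
    | or₂ h => exact .inr (.inl (.inr (.inr h)))
    | andL₁ h => exact .inr (.inr (.inl (.inl (.inl h))))
    | andL₂ h => exact .inr (.inr (.inl (.inl (.inr h))))
    | orL h₁ h₂ => exact .inr (.inr (.inl (.inl ⟨h₁, h₂⟩)))
    | andR₁ h => exact .inr (.inr (.inl (.inr (.inl h))))
    | andR₂ h => exact .inr (.inr (.inl (.inr (.inr h))))
    | orR h₁ h₂ => exact .inr (.inr (.inl (.inr ⟨h₁, h₂⟩)))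
    | dia h => exact .inr (.inr (.inr ⟨_, _, _, _, rfl, rfl, rfl, h⟩))
  · rintro ((h | h) | (rfl | h) | (h | h) | ⟨a, x, y, z, rfl, rfl, rfl, h⟩)
    · exact .unsatL h
    · exact .unsatR h
    · exact .tt
    · cases z with
      | and => exact .and h.1 h.2
      | or => exact h.elim .or₁ .or₂
      | _ => exact h.elim
    · cases x with
      | and => exact h.elim .andL₁ .andL₂
      | or => exact .orL h.1 h.2
      | _ => exact h.elim
    · cases y with
      | and => exact h.elim .andR₁ .andR₂
      | or => exact .orR h.1 h.2
      | _ => exact h.elim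
    · exact .dia h

/-! ### Subformulas in a word -/

/-- The code of `φ` stands at position `i` of the word `w`. -/
def At (name : Act → ℕ) (w : List ℕ) (i : ℕ) (φ : Formula Act) : Prop :=
  φ.code name <+: w.drop i

variable {name : Act → ℕ}

theorem length_code (φ : Formula Act) : (φ.code name).length = φ.size := by
  induction φ with
  | tt => rfl
  | ff => rfl
  | and φ ψ h₁ h₂ => simp [code, size, h₁, h₂]; omega
  | or φ ψ h₁ h₂ => simp [code, size, h₁, h₂]; omega
  | dia a φ h => simp [code, size, h]; omega

theorem size_pos (φ : Formula Act) : 0 < φ.size := by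
  cases φ <;> simp only [size] <;> omega

/-- Hence the value `0` read past the end of the input marks the end unambiguously. -/
theorem pos_of_mem_code {φ : Formula Act} {a : ℕ} (h : a ∈ φ.code name) : 0 < a := by
  induction φ with
  | tt => simp only [code, List.mem_singleton] at h; omega
  | ff => simp only [code, List.mem_singleton] at h; omega
  | and φ ψ h₁ h₂ =>
    simp only [code, List.mem_cons, List.mem_append] at h
    rcases h with rfl | h | h
    exacts [by omega, h₁ h, h₂ h]
  | or φ ψ h₁ h₂ =>
    simp only [code, List.mem_cons, List.mem_append] at h
    rcases h with rfl | h | h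
    exacts [by omega, h₁ h, h₂ h]
  | dia a φ ih =>
    simp only [code, List.mem_cons] at h
    rcases h with rfl | h
    exacts [by omega, ih h]

theorem drop_add_of_prefix {u v w : List ℕ} {i : ℕ} (h : u ++ v <+: w.drop i) :
    v <+: w.drop (i + u.length) := by
  obtain ⟨t, ht⟩ := h
  refine ⟨t, ?_⟩
  rw [← List.drop_drop, ← ht, List.append_assoc, List.drop_left]

theorem getD_of_prefix {a : ℕ} {v w : List ℕ} {i : ℕ} (h : a :: v <+: w.drop i) :
    w.getD i 0 = a := by
  obtain ⟨t, ht⟩ := h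
  have h0 : (w.drop i)[0]? = some a := by rw [← ht]; rfl
  rw [List.getElem?_drop, Nat.add_zero] at h0
  rw [List.getD_eq_getElem?_getD, h0]
  rfl

theorem At.le_length {w : List ℕ} {i : ℕ} {φ : Formula Act} (h : At name w i φ) :
    i + φ.size ≤ w.length := by
  have := h.length_le
  rw [length_code, List.length_drop] at this
  have := φ.size_pos
  omega

theorem At.and_letter {w : List ℕ} {i : ℕ} {φ ψ : Formula Act} (h : At name w i (and φ ψ)) :
    w.getD i 0 = 3 := getD_of_prefix h

theorem At.or_letter {w : List ℕ} {i : ℕ} {φ ψ : Formula Act} (h : At name w i (or φ ψ)) :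
    w.getD i 0 = 4 := getD_of_prefix h

theorem At.tt_letter {w : List ℕ} {i : ℕ} (h : At name w i tt) : w.getD i 0 = 1 :=
  getD_of_prefix h

theorem At.ff_letter {w : List ℕ} {i : ℕ} (h : At name w i ff) : w.getD i 0 = 2 :=
  getD_of_prefix h

theorem At.dia_letter {w : List ℕ} {i : ℕ} {a : Act} {φ : Formula Act}
    (h : At name w i (dia a φ)) : w.getD i 0 = 5 + name a := getD_of_prefix h

theorem At.and_left {w : List ℕ} {i : ℕ} {φ ψ : Formula Act} (h : At name w i (and φ ψ)) :
    At name w (i + 1) φ :=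
  (List.prefix_append _ _).trans (drop_add_of_prefix (u := [3]) h)

theorem At.or_left {w : List ℕ} {i : ℕ} {φ ψ : Formula Act} (h : At name w i (or φ ψ)) :
    At name w (i + 1) φ :=
  (List.prefix_append _ _).trans (drop_add_of_prefix (u := [4]) h)

theorem At.and_right {w : List ℕ} {i : ℕ} {φ ψ : Formula Act} (h : At name w i (and φ ψ)) :
    At name w (i + 1 + φ.size) ψ := by
  rw [← length_code (name := name)]
  exact drop_add_of_prefix (drop_add_of_prefix (u := [3]) h)

theorem At.or_right {w : List ℕ} {i : ℕ} {φ ψ : Formula Act} (h : At name w i (or φ ψ)) :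
    At name w (i + 1 + φ.size) ψ := by
  rw [← length_code (name := name)]
  exact drop_add_of_prefix (drop_add_of_prefix (u := [4]) h)

theorem At.dia_sub {w : List ℕ} {i : ℕ} {a : Act} {φ : Formula Act}
    (h : At name w i (dia a φ)) : At name w (i + 1) φ :=
  drop_add_of_prefix (u := [5 + name a]) h

theorem at_zero (φ : Formula Act) : At name (φ.code name) 0 φ := List.prefix_refl _

/-- In prefix notation every letter begins a subformula, so the tables can be indexed by all
positions of the word. -/
theorem At.exists_at {w : List ℕ} {i : ℕ} {φ : Formula Act} (h : At name w i φ) {j : ℕ}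
    (hij : i ≤ j) (hj : j < i + φ.size) : ∃ ψ : Formula Act, At name w j ψ := by
  induction φ generalizing i with
  | tt =>
    obtain rfl : j = i := by simp only [size] at hj; omega
    exact ⟨_, h⟩
  | ff =>
    obtain rfl : j = i := by simp only [size] at hj; omega
    exact ⟨_, h⟩
  | and φ ψ h₁ h₂ =>
    simp only [size] at hj
    rcases hij.eq_or_lt with rfl | hij
    · exact ⟨_, h⟩
    by_cases hc : j < i + 1 + φ.size
    · exact h₁ h.and_left hij hc
    · exact h₂ h.and_right (by omega) (by omega)
  | or φ ψ h₁ h₂ =>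
    simp only [size] at hj
    rcases hij.eq_or_lt with rfl | hij
    · exact ⟨_, h⟩
    by_cases hc : j < i + 1 + φ.size
    · exact h₁ h.or_left hij hc
    · exact h₂ h.or_right (by omega) (by omega)
  | dia a φ ih =>
    simp only [size] at hj
    rcases hij.eq_or_lt with rfl | hij
    · exact ⟨_, h⟩
    exact ih h.dia_sub hij (by omega)

end Formula

end SimLogic

namespace RAM

/-! ### Executions with bounded memory -/

/-- All cells hold numbers up to `W`. -/
def MemLe (m : ℕ → ℕ) (W : ℕ) : Prop := ∀ i, m i ≤ W

theorem MemLe.update {m : ℕ → ℕ} {W : ℕ} (h : MemLe m W) (d : ℕ) {v : ℕ} (hv : v ≤ W) :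
    MemLe (Function.update m d v) W := by
  intro i
  by_cases hi : i = d
  · subst hi; simpa using hv
  · simpa [hi] using h i

/-- The machine goes from `s` to `s'` in `t` steps, all cells staying at most `W`. -/
def Reach (P : Program) (x : List ℕ) (W t : ℕ) (s s' : Config) : Prop :=
  (step P x)^[t] s = s' ∧ ∀ r ≤ t, MemLe ((step P x)^[r] s).mem W

section Reach

variable {P : Program} {x : List ℕ} {W : ℕ}

theorem Reach.trans {t t' : ℕ} {s s' s'' : Config} (h : Reach P x W t s s')
    (h' : Reach P x W t' s' s'') : Reach P x W (t + t') s s'' := by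
  refine ⟨?_, fun r hr => ?_⟩
  · rw [Nat.add_comm, Function.iterate_add_apply, h.1, h'.1]
  · rcases le_total r t with hrt | hrt
    · exact h.2 r hrt
    · obtain ⟨k, rfl⟩ := Nat.exists_eq_add_of_le hrt
      rw [Nat.add_comm, Function.iterate_add_apply, h.1]
      exact h'.2 k (by omega)

theorem Reach.memLe_right {t l : ℕ} {s : Config} {m : ℕ → ℕ} (h : Reach P x W t s ⟨l, m⟩) :
    MemLe m W := by
  have := h.2 t le_rfl
  rwa [h.1] at this

/-- The instructions `L` stand in `P` from number `l` on. -/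
def HasCode (P : Program) (l : ℕ) (L : List Instr) : Prop :=
  L <+: P.drop l

theorem HasCode.left {l : ℕ} {L L' : List Instr} (h : HasCode P l (L ++ L')) : HasCode P l L :=
  (List.prefix_append _ _).trans h

theorem HasCode.right {l : ℕ} {L L' : List Instr} (h : HasCode P l (L ++ L')) :
    HasCode P (l + L.length) L' := by
  obtain ⟨t, ht⟩ := h
  refine ⟨t, ?_⟩
  rw [← List.drop_drop, ← ht, List.append_assoc, List.drop_left]

theorem HasCode.tail {l : ℕ} {i : Instr} {L : List Instr} (h : HasCode P l (i :: L)) :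
    HasCode P (l + 1) L :=
  HasCode.right (L := [i]) h

theorem HasCode.getElem? {l : ℕ} {i : Instr} {L : List Instr} (h : HasCode P l (i :: L)) :
    P[l]? = some i := by
  obtain ⟨t, ht⟩ := h
  have h0 : (P.drop l)[0]? = some i := by rw [← ht]; rfl
  rwa [List.getElem?_drop, Nat.add_zero] at h0

theorem HasCode.step {l : ℕ} {i : Instr} {L : List Instr} (h : HasCode P l (i :: L))
    {m : ℕ → ℕ} (hm : MemLe m W) {s' : Config} (hs : i.exec x ⟨l, m⟩ = s')
    (hm' : MemLe s'.mem W) : Reach P x W 1 ⟨l, m⟩ s' := by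
  have hstep : RAM.step P x ⟨l, m⟩ = s' := by simp only [RAM.step, h.getElem?, hs]
  refine ⟨hstep, fun r hr => ?_⟩
  obtain rfl | rfl : r = 0 ∨ r = 1 := by omega
  · exact hm
  · simpa [hstep] using hm'

/-- One non-jumping instruction that changes cell `d` to `v`. -/
theorem HasCode.step_update {l : ℕ} {i : Instr} {L : List Instr} (h : HasCode P l (i :: L))
    {m : ℕ → ℕ} (hm : MemLe m W) {d v : ℕ}
    (hs : i.exec x ⟨l, m⟩ = ⟨l + 1, Function.update m d v⟩) (hv : v ≤ W) :
    Reach P x W 1 ⟨l, m⟩ ⟨l + 1, Function.update m d v⟩ :=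
  h.step hm hs (hm.update d hv)

end Reach

/-! ### A while language -/

/-- Numerical variables and six arrays. -/
structure State : Type where
  var : ℕ → ℕ
  arr : Fin 6 → ℕ → ℕ

namespace State

def setVar (σ : State) (v a : ℕ) : State := ⟨Function.update σ.var v a, σ.arr⟩

def setArr (σ : State) (k : Fin 6) (i a : ℕ) : State :=
  ⟨σ.var, Function.update σ.arr k (Function.update (σ.arr k) i a)⟩

@[simp] theorem setVar_var (σ : State) (v a u : ℕ) :
    (σ.setVar v a).var u = if u = v then a else σ.var u := by
  simp [setVar, Function.update_apply]

@[simp] theorem setVar_arr (σ : State) (v a : ℕ) : (σ.setVar v a).arr = σ.arr := rfl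

@[simp] theorem setArr_var (σ : State) (k : Fin 6) (i a : ℕ) : (σ.setArr k i a).var = σ.var := rfl

@[simp] theorem setArr_arr (σ : State) (k k' : Fin 6) (i i' a : ℕ) :
    (σ.setArr k i a).arr k' i' = if k' = k ∧ i' = i then a else σ.arr k' i' := by
  by_cases hk : k' = k
  · subst hk
    by_cases hi : i' = i <;> simp [setArr, hi]
  · simp [setArr, hk]

/-- The cells that represent a state: variable `v` is cell `8 * v`, and entry `i` of array `k` is
cell `8 * i + (k + 2)`. -/
def Rep (σ : State) (m : ℕ → ℕ) : Prop :=
  (∀ v, m (8 * v) = σ.var v) ∧ ∀ (k : Fin 6) (i : ℕ), m (8 * i + (k + 2)) = σ.arr k i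

/-- The cell of a temporary value. -/
def tmp (d : ℕ) : ℕ := 8 * d + 1

/-- Modulo `8`, variables have residue `0`, temporaries `1` and the six arrays `2` to `7`, so writes
of different kinds never collide. -/
theorem Rep.update_tmp {σ : State} {m : ℕ → ℕ} (h : σ.Rep m) (d v : ℕ) :
    σ.Rep (Function.update m (tmp d) v) := by
  refine ⟨fun u => ?_, fun k i => ?_⟩
  · rw [Function.update_of_ne (by unfold tmp; omega), h.1]
  · rw [Function.update_of_ne (by unfold tmp; omega), h.2]

theorem Rep.setVar {σ : State} {m : ℕ → ℕ} (h : σ.Rep m) (v a : ℕ) :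
    (σ.setVar v a).Rep (Function.update m (8 * v) a) := by
  refine ⟨fun u => ?_, fun k i => ?_⟩
  · by_cases hu : u = v
    · subst hu; simp
    · rw [Function.update_of_ne (by omega), h.1]; simp [hu]
  · rw [Function.update_of_ne (by omega), h.2]; rfl

theorem Rep.setArr {σ : State} {m : ℕ → ℕ} (h : σ.Rep m) (k : Fin 6) (i a : ℕ) :
    (σ.setArr k i a).Rep (Function.update m (8 * i + (k + 2)) a) := by
  refine ⟨fun u => ?_, fun k' i' => ?_⟩
  · rw [Function.update_of_ne (by omega), h.1]; rfl
  · rw [setArr_arr]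
    split_ifs with hc
    · rw [hc.1, hc.2]; simp
    · rw [Function.update_of_ne, h.2]
      intro he
      refine hc ⟨Fin.ext ?_, ?_⟩ <;> omega

end State

open State (tmp)

theorem tmp_inj {d e : ℕ} : tmp d = tmp e ↔ d = e := by unfold tmp; omega

/-- Expressions. -/
inductive Expr : Type
  | const (c : ℕ) : Expr
  | var (v : ℕ) : Expr
  | arr (k : Fin 6) (e : Expr) : Expr
  | read (e : Expr) : Expr
  | add (a b : Expr) : Expr
  | sub (a b : Expr) : Expr

/-- Turn an index in the cell `tmp d` into the address of that entry of array `k`. -/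
def addrCode (k : Fin 6) (d : ℕ) : List Instr :=
  [.add (tmp d) (tmp d) (tmp d), .add (tmp d) (tmp d) (tmp d), .add (tmp d) (tmp d) (tmp d),
    .const (tmp (d + 1)) (k + 2), .add (tmp d) (tmp d) (tmp (d + 1))]

namespace Expr

def eval (x : List ℕ) (σ : State) : Expr → ℕ
  | const c => c
  | var v => σ.var v
  | arr k e => σ.arr k (e.eval x σ)
  | read e => x.getD (e.eval x σ) 0
  | add a b => a.eval x σ + b.eval x σ
  | sub a b => a.eval x σ - b.eval x σ

/-- The evaluation involves only numbers up to `W`. -/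
def Bdd (x : List ℕ) (σ : State) (W : ℕ) : Expr → Prop
  | const c => c ≤ W
  | var _ => True
  | arr k e => e.Bdd x σ W ∧ 8 * e.eval x σ + (k + 2) ≤ W
  | read e => e.Bdd x σ W
  | add a b => a.Bdd x σ W ∧ b.Bdd x σ W ∧ a.eval x σ + b.eval x σ ≤ W
  | sub a b => a.Bdd x σ W ∧ b.Bdd x σ W

/-- Code that leaves the value in the cell `tmp d`. -/
def code : Expr → ℕ → List Instr
  | const c, d => [.const (tmp d) c]
  | var v, d => [.const (tmp d) 0, .add (tmp d) (tmp d) (8 * v)]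
  | arr k e, d => e.code d ++ (addrCode k d ++ [.load (tmp d) (tmp d)])
  | read e, d => e.code d ++ [.read (tmp d) (tmp d)]
  | add a b, d => a.code d ++ (b.code (d + 1) ++ [.add (tmp d) (tmp d) (tmp (d + 1))])
  | sub a b, d => a.code d ++ (b.code (d + 1) ++ [.sub (tmp d) (tmp d) (tmp (d + 1))])

/-- The length of the code. -/
def len : Expr → ℕ
  | const _ => 1
  | var _ => 2
  | arr _ e => e.len + 6
  | read e => e.len + 1
  | add a b => a.len + b.len + 1
  | sub a b => a.len + b.len + 1

@[simp] theorem length_code (e : Expr) (d : ℕ) : (e.code d).length = e.len := by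
  induction e generalizing d with
  | const c => rfl
  | var v => rfl
  | arr k e ih => simp [code, len, ih, addrCode]
  | read e ih => simp [code, len, ih]
  | add a b iha ihb => simp [code, len, iha, ihb]; omega
  | sub a b iha ihb => simp [code, len, iha, ihb]; omega

end Expr

/-! ### Correctness of compiled expressions -/

section Compile

variable {P : Program} {x : List ℕ} {W : ℕ}

/-- Three doublings stand in for a multiplication by `8`. The bound on the final address covers all
intermediate values. -/
theorem reach_addrCode {k : Fin 6} {d l : ℕ} {m : ℕ → ℕ} {σ : State}
    (hP : HasCode P l (addrCode k d)) (hσ : σ.Rep m) (hm : MemLe m W)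
    (hb : 8 * m (tmp d) + (k + 2) ≤ W) :
    ∃ m', Reach P x W 5 ⟨l, m⟩ ⟨l + 5, m'⟩ ∧ σ.Rep m' ∧
      m' (tmp d) = 8 * m (tmp d) + (k + 2) ∧ ∀ d' < d, m' (tmp d') = m (tmp d') := by
  set v := m (tmp d) with hv
  have hne : tmp d ≠ tmp (d + 1) := by rw [Ne, tmp_inj]; omega
  have r1 := hP.step_update (x := x) hm (d := tmp d) (v := 2 * v)
    (by simp only [Instr.exec, ← hv, two_mul]) (by omega)
  set m1 := Function.update m (tmp d) (2 * v) with hm1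
  have e1 : m1 (tmp d) = 2 * v := by simp [hm1]
  have r2 := hP.tail.step_update (x := x) r1.memLe_right (d := tmp d) (v := 4 * v)
    (by simp only [Instr.exec, e1]; congr 2; omega) (by omega)
  set m2 := Function.update m1 (tmp d) (4 * v) with hm2
  have e2 : m2 (tmp d) = 4 * v := by simp [hm2]
  have r3 := hP.tail.tail.step_update (x := x) r2.memLe_right (d := tmp d) (v := 8 * v)
    (by simp only [Instr.exec, e2]; congr 2; omega) (by omega)
  set m3 := Function.update m2 (tmp d) (8 * v) with hm3
  have e3 : m3 (tmp d) = 8 * v := by simp [hm3]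
  have r4 := hP.tail.tail.tail.step_update (x := x) r3.memLe_right (d := tmp (d + 1))
    (v := k + 2) rfl (by omega)
  set m4 := Function.update m3 (tmp (d + 1)) (k + 2) with hm4
  have e4 : m4 (tmp d) = 8 * v := by rw [hm4, Function.update_of_ne hne, e3]
  have e4' : m4 (tmp (d + 1)) = k + 2 := by simp [hm4]
  have r5 := hP.tail.tail.tail.tail.step_update (x := x) r4.memLe_right (d := tmp d)
    (v := 8 * v + (k + 2)) (by simp only [Instr.exec, e4, e4']) hb
  refine ⟨_, (((r1.trans r2).trans r3).trans r4).trans r5, ?_, by simp, fun d' hd' => ?_⟩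
  · exact ((((hσ.update_tmp _ _).update_tmp _ _).update_tmp _ _).update_tmp _ _).update_tmp _ _
  · have n1 : tmp d' ≠ tmp d := by rw [Ne, tmp_inj]; omega
    have n2 : tmp d' ≠ tmp (d + 1) := by rw [Ne, tmp_inj]; omega
    simp only [hm4, hm3, hm2, hm1, Function.update_of_ne n1, Function.update_of_ne n2]

/-- The temporaries form a stack: evaluation at depth `d` leaves those below `d` intact, which
preserves a left operand while the right one is evaluated at depth `d + 1`. -/
theorem Expr.reach_code (hx : ∀ a ∈ x, a ≤ W) (e : Expr) {d l : ℕ} {m : ℕ → ℕ} {σ : State}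
    (hP : HasCode P l (e.code d)) (hσ : σ.Rep m) (hm : MemLe m W) (hb : e.Bdd x σ W) :
    ∃ m', Reach P x W e.len ⟨l, m⟩ ⟨l + e.len, m'⟩ ∧ σ.Rep m' ∧
      m' (tmp d) = e.eval x σ ∧ ∀ d' < d, m' (tmp d') = m (tmp d') := by
  induction e generalizing d l m with
  | const c =>
    refine ⟨_, hP.step_update hm rfl hb, hσ.update_tmp _ _, by simp [eval], fun d' hd' => ?_⟩
    rw [Function.update_of_ne (by rw [Ne, tmp_inj]; omega)]
  | var v =>
    have r1 := hP.step_update (x := x) hm (d := tmp d) (v := 0) rfl (Nat.zero_le _)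
    have h1 := hσ.update_tmp d 0
    have r2 := hP.tail.step_update (x := x) r1.memLe_right (d := tmp d) (v := σ.var v)
      (by simp only [Instr.exec, h1.1, Function.update_self, Nat.zero_add])
      (by rw [← hσ.1 v]; exact hm _)
    refine ⟨_, r1.trans r2, h1.update_tmp _ _, by simp [eval], fun d' hd' => ?_⟩
    rw [Function.update_of_ne (by rw [Ne, tmp_inj]; omega),
      Function.update_of_ne (by rw [Ne, tmp_inj]; omega)]
  | arr k e ih =>
    obtain ⟨m1, r1, h1, v1, f1⟩ := ih hP.left hσ hm hb.1
    have hP1 := hP.right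
    rw [length_code] at hP1
    obtain ⟨m2, r2, h2, v2, f2⟩ := reach_addrCode (x := x) hP1.left h1 r1.memLe_right
      (by rw [v1]; exact hb.2)
    have hval : m2 (m2 (tmp d)) = σ.arr k (e.eval x σ) := by rw [v2, v1, h2.2]
    have r3 := hP1.right.step_update (x := x) r2.memLe_right (d := tmp d)
      (v := σ.arr k (e.eval x σ)) (by simp only [Instr.exec, hval])
      (by rw [← hval]; exact r2.memLe_right _)
    refine ⟨_, (r1.trans r2).trans r3, h2.update_tmp _ _, by simp [eval], fun d' hd' => ?_⟩
    rw [Function.update_of_ne (by rw [Ne, tmp_inj]; omega), f2 d' hd', f1 d' hd']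
  | read e ih =>
    obtain ⟨m1, r1, h1, v1, f1⟩ := ih hP.left hσ hm hb
    have hP1 := hP.right
    rw [length_code] at hP1
    have r2 := hP1.step_update (x := x) r1.memLe_right (d := tmp d)
      (v := x.getD (e.eval x σ) 0) (by simp only [Instr.exec, v1]) (by
        rw [List.getD_eq_getElem?_getD]
        rcases h : x[e.eval x σ]? with _ | a
        · simp
        · simpa using hx a (List.mem_of_getElem? h))
    refine ⟨_, r1.trans r2, h1.update_tmp _ _, by simp [eval], fun d' hd' => ?_⟩
    rw [Function.update_of_ne (by rw [Ne, tmp_inj]; omega), f1 d' hd']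
  | add a b iha ihb =>
    obtain ⟨m1, r1, h1, v1, f1⟩ := iha hP.left hσ hm hb.1
    have hP1 := hP.right
    rw [length_code] at hP1
    obtain ⟨m2, r2, h2, v2, f2⟩ := ihb hP1.left h1 r1.memLe_right hb.2.1
    have hP2 := hP1.right
    rw [length_code] at hP2
    have r3 := hP2.step_update (x := x) r2.memLe_right (d := tmp d)
      (v := a.eval x σ + b.eval x σ)
      (by simp only [Instr.exec, v2, f2 d (Nat.lt_succ_self d), v1]) hb.2.2
    have r := (r1.trans r2).trans r3
    rw [Nat.add_assoc l, Nat.add_assoc l] at r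
    refine ⟨_, r, h2.update_tmp _ _, by simp [eval], fun d' hd' => ?_⟩
    rw [Function.update_of_ne (by rw [Ne, tmp_inj]; omega), f2 d' (by omega), f1 d' hd']
  | sub a b iha ihb =>
    obtain ⟨m1, r1, h1, v1, f1⟩ := iha hP.left hσ hm hb.1
    have hP1 := hP.right
    rw [length_code] at hP1
    obtain ⟨m2, r2, h2, v2, f2⟩ := ihb hP1.left h1 r1.memLe_right hb.2
    have hP2 := hP1.right
    rw [length_code] at hP2
    have r3 := hP2.step_update (x := x) r2.memLe_right (d := tmp d)
      (v := a.eval x σ - b.eval x σ)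
      (by simp only [Instr.exec, v2, f2 d (Nat.lt_succ_self d), v1])
      -- A truncated difference is at most its left operand, which has already been held in a cell.
      (by have := r1.memLe_right (tmp d)
          simp only [v1] at this
          omega)
    have r := (r1.trans r2).trans r3
    rw [Nat.add_assoc l, Nat.add_assoc l] at r
    refine ⟨_, r, h2.update_tmp _ _, by simp [eval], fun d' hd' => ?_⟩
    rw [Function.update_of_ne (by rw [Ne, tmp_inj]; omega), f2 d' (by omega), f1 d' hd']

end Compile

/-! ### Commands and a calculus of timed correctness -/

/-- Commands. -/
inductive Cmd : Type
  | assign (v : ℕ) (e : Expr) : Cmd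
  | put (k : Fin 6) (i e : Expr) : Cmd
  | seq (c c' : Cmd) : Cmd
  | loop (e : Expr) (c : Cmd) : Cmd

namespace Cmd

/-- The length of the code. -/
def len : Cmd → ℕ
  | assign _ e => e.len + 2
  | put _ i e => i.len + e.len + 6
  | seq c c' => c.len + c'.len
  | loop e c => e.len + c.len + 3

/-- The code, placed at instruction number `l`. -/
def code : Cmd → ℕ → List Instr
  | assign v e, _ => e.code 0 ++ [.const (tmp 1) 0, .add (8 * v) (tmp 0) (tmp 1)]
  | put k i e, _ => i.code 0 ++ (addrCode k 0 ++ (e.code 1 ++ [.store (tmp 0) (tmp 1)]))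
  | seq c c', l => c.code l ++ c'.code (l + c.len)
  | loop e c, l => e.code 0 ++ (.jzero (tmp 0) (l + (e.len + c.len + 3)) ::
      (c.code (l + e.len + 1) ++ [.const (tmp 0) 0, .jzero (tmp 0) l]))

@[simp] theorem length_code (c : Cmd) (l : ℕ) : (c.code l).length = c.len := by
  induction c generalizing l with
  | assign v e => simp [code, len]
  | put k i e => simp [code, len, addrCode]; omega
  | seq c c' ih ih' => simp [code, len, ih, ih']
  | loop e c ih => simp [code, len, ih]; omega

end Cmd

/-- Started in the state `σ`, the command `c` ends after at most `T` steps in a state that satisfies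
`Q`, all numbers staying at most `W`. -/
def Does (x : List ℕ) (W : ℕ) (c : Cmd) (σ : State) (T : ℕ) (Q : State → Prop) : Prop :=
  ∀ (P : Program) (l : ℕ) (m : ℕ → ℕ), HasCode P l (c.code l) → σ.Rep m → MemLe m W →
    ∃ t ≤ T, ∃ m', Reach P x W t ⟨l, m⟩ ⟨l + c.len, m'⟩ ∧ ∃ σ', State.Rep σ' m' ∧ Q σ'

namespace Does

variable {x : List ℕ} {W : ℕ} {σ : State} {T : ℕ} {Q : State → Prop}

theorem mono {c : Cmd} (h : Does x W c σ T Q) {T' : ℕ} (hT : T ≤ T') {Q' : State → Prop}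
    (hQ : ∀ σ, Q σ → Q' σ) : Does x W c σ T' Q' := by
  intro P l m hP hσ hm
  obtain ⟨t, ht, m', r, σ', h', q⟩ := h P l m hP hσ hm
  exact ⟨t, ht.trans hT, m', r, σ', h', hQ _ q⟩

theorem assign (hx : ∀ a ∈ x, a ≤ W) {v : ℕ} {e : Expr} (hb : e.Bdd x σ W)
    (hQ : Q (σ.setVar v (e.eval x σ))) : Does x W (.assign v e) σ (e.len + 2) Q := by
  intro P l m hP hσ hm
  obtain ⟨m1, r1, h1, v1, -⟩ := e.reach_code hx hP.left hσ hm hb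
  have hP1 := hP.right
  rw [Expr.length_code] at hP1
  -- The machine has no copy instruction; a value is moved by adding zero to it.
  have r2 := hP1.step_update (x := x) r1.memLe_right (d := tmp 1) (v := 0) rfl (Nat.zero_le _)
  have hv : Function.update m1 (tmp 1) 0 (tmp 0) = e.eval x σ := by
    rw [Function.update_of_ne (by decide), v1]
  have r3 := hP1.tail.step_update (x := x) r2.memLe_right (d := 8 * v) (v := e.eval x σ)
    (by simp only [Instr.exec, hv, Function.update_self, Nat.add_zero])
    (by rw [← v1]; exact r1.memLe_right _)
  exact ⟨_, le_rfl, _, (r1.trans r2).trans r3, _, (h1.update_tmp _ _).setVar _ _, hQ⟩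

theorem put (hx : ∀ a ∈ x, a ≤ W) {k : Fin 6} {i e : Expr} (hi : i.Bdd x σ W)
    (hi' : 8 * i.eval x σ + (k + 2) ≤ W) (hb : e.Bdd x σ W)
    (hQ : Q (σ.setArr k (i.eval x σ) (e.eval x σ))) :
    Does x W (.put k i e) σ (i.len + e.len + 6) Q := by
  intro P l m hP hσ hm
  obtain ⟨m1, r1, h1, v1, -⟩ := i.reach_code hx hP.left hσ hm hi
  have hP1 := hP.right
  rw [Expr.length_code] at hP1
  obtain ⟨m2, r2, h2, v2, -⟩ := reach_addrCode (x := x) hP1.left h1 r1.memLe_right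
    (by rw [v1]; exact hi')
  have hP2 : HasCode P (l + i.len + 5) _ := hP1.right
  obtain ⟨m3, r3, h3, v3, f3⟩ := e.reach_code hx hP2.left h2 r2.memLe_right hb
  have hP3 := hP2.right
  rw [Expr.length_code] at hP3
  have r4 := hP3.step_update (x := x) r3.memLe_right (d := 8 * i.eval x σ + (k + 2))
    (v := e.eval x σ) (by simp only [Instr.exec, v3, f3 0 Nat.one_pos, v2, v1])
    (by rw [← v3]; exact r3.memLe_right _)
  have r := ((r1.trans r2).trans r3).trans r4
  have hl : l + i.len + 5 + e.len + 1 = l + (Cmd.put k i e).len := by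
    simp only [Cmd.len]; omega
  rw [hl] at r
  exact ⟨_, by omega, _, r, _, h3.setArr _ _ _, hQ⟩

/-- The postcondition of `c` is the judgement about `c'`, so no intermediate assertion has to be
named. -/
theorem seq {c c' : Cmd} {T' : ℕ} (h : Does x W c σ T fun σ' => Does x W c' σ' T' Q) :
    Does x W (.seq c c') σ (T + T') Q := by
  intro P l m hP hσ hm
  obtain ⟨t, ht, m1, r1, σ', h1, q⟩ := h P l m hP.left hσ hm
  have hP1 := hP.right
  rw [Cmd.length_code] at hP1
  obtain ⟨t', ht', m2, r2, q'⟩ := q P _ m1 hP1 h1 r1.memLe_right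
  have r := r1.trans r2
  rw [Nat.add_assoc l] at r
  exact ⟨_, Nat.add_le_add ht ht', m2, r, q'⟩

/-- The loop rule: `I r` holds when `r` rounds remain. -/
theorem loop (hx : ∀ a ∈ x, a ≤ W) {e : Expr} {c : Cmd} (I : ℕ → State → Prop)
    (hend : ∀ σ, I 0 σ → e.Bdd x σ W ∧ e.eval x σ = 0 ∧ Q σ)
    (hstep : ∀ r σ, I (r + 1) σ → e.Bdd x σ W ∧ e.eval x σ ≠ 0 ∧ Does x W c σ T (I r))
    {r : ℕ} (hσ : I r σ) :
    Does x W (.loop e c) σ (r * (T + e.len + 3) + e.len + 1) Q := by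
  induction r generalizing σ with
  | zero =>
    intro P l m hP h hm
    obtain ⟨hb, he, q⟩ := hend σ hσ
    obtain ⟨m1, r1, h1, v1, -⟩ := e.reach_code hx hP.left h hm hb
    have hP1 := hP.right
    rw [Expr.length_code] at hP1
    have r2 := hP1.step (x := x) r1.memLe_right
      (s' := ⟨l + (Cmd.loop e c).len, m1⟩)
      (by simp only [Instr.exec, v1, he, if_true]; rfl) r1.memLe_right
    exact ⟨_, by omega, m1, r1.trans r2, σ, h1, q⟩
  | succ r ih =>
    intro P l m hP h hm
    obtain ⟨hb, he, hc⟩ := hstep r σ hσ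
    obtain ⟨m1, r1, h1, v1, -⟩ := e.reach_code hx hP.left h hm hb
    have hP1 := hP.right
    rw [Expr.length_code] at hP1
    have r2 := hP1.step (x := x) r1.memLe_right (s' := ⟨l + e.len + 1, m1⟩)
      (by simp only [Instr.exec, v1, he, if_false]) r1.memLe_right
    have hP2 := hP1.tail
    obtain ⟨t, ht, m3, r3, σ3, h3, q3⟩ := hc P _ m1 hP2.left h1 r1.memLe_right
    have hP3 := hP2.right
    rw [Cmd.length_code] at hP3
    -- An unconditional jump back is a conditional one on a cell just cleared.
    have r4 := hP3.step_update (x := x) r3.memLe_right (d := tmp 0) (v := 0) rfl (Nat.zero_le _)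
    have r5 := hP3.tail.step (x := x) r4.memLe_right
      (s' := ⟨l, Function.update m3 (tmp 0) 0⟩)
      (by simp only [Instr.exec, Function.update_self, if_true]) r4.memLe_right
    obtain ⟨t', ht', m6, r6, q⟩ := ih q3 P l _ hP (h3.update_tmp 0 0) r4.memLe_right
    refine ⟨_, ?_, m6, ((((r1.trans r2).trans r3).trans r4).trans r5).trans r6, q⟩
    -- A round consists of the test, the exit jump, the body and the two instructions that jump
    -- back.
    have : (r + 1) * (T + e.len + 3) = r * (T + e.len + 3) + (T + e.len + 3) := by ring
    omega

end Does

/-- `for v = e - 1, …, 0 do c`, where `c` does not change `v`. -/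
def Cmd.down (v : ℕ) (e : Expr) (c : Cmd) : Cmd :=
  .seq (.assign v e) (.loop (.var v) (.seq (.assign v (.sub (.var v) (.const 1))) c))

theorem Does.down {x : List ℕ} {W : ℕ} {σ : State} {T : ℕ} {Q : State → Prop}
    (hx : ∀ a ∈ x, a ≤ W) (hW : 1 ≤ W) {v : ℕ} {e : Expr} {c : Cmd} {r : ℕ}
    (he : e.Bdd x σ W) (hr : e.eval x σ = r) (I : ℕ → State → Prop)
    (hI : I r (σ.setVar v r))
    (hstep : ∀ i σ, I (i + 1) σ → σ.var v = i + 1 → i < r →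
      Does x W c (σ.setVar v i) T fun σ' => I i σ' ∧ σ'.var v = i)
    (hend : ∀ σ, I 0 σ → Q σ) :
    Does x W (.down v e c) σ (r * (T + 11) + e.len + 5) Q := by
  -- Decrementing `v` takes `6` steps, testing it `2`, and the loop itself `3` per round.
  refine mono (T := (e.len + 2) + (r * ((6 + T) + 2 + 3) + 2 + 1)) (Q := Q) ?_
    (by rw [show 6 + T + 2 + 3 = T + 11 by omega]; omega) fun _ h => h
  refine seq (assign hx he (loop hx
    (fun i σ' => I i σ' ∧ σ'.var v = i ∧ i ≤ r) ?_ ?_ (r := r) ?_))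
  · exact fun σ h => ⟨trivial, h.2.1, hend σ h.1⟩
  · intro i σ h
    refine ⟨trivial, by simp [Expr.eval, h.2.1], ?_⟩
    refine seq (assign hx ⟨trivial, hW⟩ ?_)
    have : (Expr.sub (.var v) (.const 1)).eval x σ = i := by simp [Expr.eval, h.2.1]
    rw [this]
    exact (hstep i σ h.1 h.2.1 (by omega)).mono le_rfl fun σ' h' => ⟨h'.1, h'.2, by omega⟩
  · rw [hr]
    exact ⟨hI, by simp, le_rfl⟩

theorem Does.decidesWithin {x : List ℕ} {W : ℕ} {c : Cmd} {T : ℕ} {A : Prop}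
    (h : Does x W c ⟨fun _ => 0, fun _ _ => 0⟩ T fun σ => σ.var 0 ≤ 1 ∧ (σ.var 0 = 1 ↔ A)) :
    DecidesWithin (c.code 0) x A T W := by
  obtain ⟨t, ht, m', r, σ', h', q₁, q₂⟩ := h (c.code 0) 0 (fun _ => 0) (List.prefix_refl _)
    ⟨fun _ => rfl, fun _ _ => rfl⟩ fun _ => Nat.zero_le _
  have hrun : run (c.code 0) x t = ⟨0 + c.len, m'⟩ := r.1
  have h0 : m' 0 = σ'.var 0 := h'.1 0
  refine ⟨t, ht, ?_, ?_, r.2⟩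
  · simp [hrun]
  · simp only [hrun, h0]
    by_cases hA : A
    · exact .inl ⟨hA, q₂.2 hA⟩
    · have : σ'.var 0 ≠ 1 := fun h => hA (q₂.1 h)
      exact .inr ⟨hA, by omega⟩

/-! ### Truth-valued expressions -/

namespace Expr

/-- Conjunction of truth values. -/
def conj (a b : Expr) : Expr := .sub a (.sub a b)

/-- Disjunction of truth values. -/
def disj (a b : Expr) : Expr := .sub (.const 1) (.sub (.const 1) (.add a b))

/-- The truth value of an equation. -/
def eqn (a b : Expr) : Expr := .sub (.const 1) (.add (.sub a b) (.sub b a))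

/-- The truth value of an inequality `a ≤ b`. -/
def leq (a b : Expr) : Expr := .sub (.const 1) (.sub a b)

/-- `e` evaluates to the truth value of `p`. -/
def Holds (x : List ℕ) (W : ℕ) (σ : State) (e : Expr) (p : Prop) : Prop :=
  e.Bdd x σ W ∧ e.eval x σ ≤ 1 ∧ (e.eval x σ = 1 ↔ p)

namespace Holds

variable {x : List ℕ} {W : ℕ} {σ : State} {a b : Expr} {p q : Prop}

theorem conj (ha : Holds x W σ a p) (hb : Holds x W σ b q) : Holds x W σ (a.conj b) (p ∧ q) := by
  obtain ⟨ba, la, ea⟩ := ha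
  obtain ⟨bb, lb, eb⟩ := hb
  refine ⟨⟨ba, ba, bb⟩, ?_, ?_⟩
  · simp only [Expr.conj, eval]; omega
  · rw [← ea, ← eb]; simp only [Expr.conj, eval]; omega

theorem disj (hW : 2 ≤ W) (ha : Holds x W σ a p) (hb : Holds x W σ b q) :
    Holds x W σ (a.disj b) (p ∨ q) := by
  obtain ⟨ba, la, ea⟩ := ha
  obtain ⟨bb, lb, eb⟩ := hb
  refine ⟨⟨(by omega : 1 ≤ W), (by omega : 1 ≤ W), ba, bb, by omega⟩, ?_, ?_⟩
  · simp only [Expr.disj, eval]; omega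
  · rw [← ea, ← eb]; simp only [Expr.disj, eval]; omega

theorem eqn (hW : 2 ≤ W) (ha : a.Bdd x σ W) (hb : b.Bdd x σ W) (ha' : a.eval x σ ≤ W)
    (hb' : b.eval x σ ≤ W) : Holds x W σ (a.eqn b) (a.eval x σ = b.eval x σ) := by
  refine ⟨⟨(by omega : 1 ≤ W), ⟨ha, hb⟩, ⟨hb, ha⟩, by simp only [eval]; omega⟩, ?_, ?_⟩
  · simp only [Expr.eqn, eval]; omega
  · simp only [Expr.eqn, eval]; omega

theorem leq (hW : 2 ≤ W) (ha : a.Bdd x σ W) (hb : b.Bdd x σ W) :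
    Holds x W σ (a.leq b) (a.eval x σ ≤ b.eval x σ) := by
  refine ⟨⟨(by omega : 1 ≤ W), ha, hb⟩, ?_, ?_⟩
  · simp only [Expr.leq, eval]; omega
  · simp only [Expr.leq, eval]; omega

theorem arr {k : Fin 6} (ha : a.Bdd x σ W) (ha' : 8 * a.eval x σ + (k + 2) ≤ W)
    (h : ∀ i, σ.arr k i ≤ 1) : Holds x W σ (.arr k a) (σ.arr k (a.eval x σ) = 1) :=
  ⟨⟨ha, ha'⟩, h _, Iff.rfl⟩

theorem congr (ha : Holds x W σ a p) (h : p ↔ q) : Holds x W σ a q :=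
  ⟨ha.1, ha.2.1, ha.2.2.trans h⟩

end Holds

end Expr

end RAM

namespace SimLogic

open RAM RAM.Expr Formula

/-! ### The program

The variables `1` to `6` hold the length `n` of the input, three positions, the number `n + 1` and
its square. The arrays `0` to `3` hold the ends of the subformulas, their unsatisfiability, the
multiples of `n + 1`, and the derivability of the triples of subformulas. -/

namespace Program

def succE (e : Expr) : Expr := .add e (.const 1)

/-- Entry `i` of array `0` is the first position after the subformula that begins at `i`. -/
def endE (e : Expr) : Expr := .arr 0 e

/-- The position of the second argument of the connective at position `e`. -/
def sndE (e : Expr) : Expr := endE (succE e)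

def unsatE (e : Expr) : Expr := .arr 1 e

/-- The place of a triple needs two products with `n + 1`, which are looked up in array `2`. -/
def derE (a b c : Expr) : Expr := .arr 3 (.add (.arr 2 (.add (.arr 2 a) b)) c)

def letterE (e : Expr) (c : ℕ) : Expr := (Expr.read e).eqn (.const c)

def isDiaE (e : Expr) : Expr := Expr.leq (.const 5) (.read e)

def leftE (e : Expr) (g : Expr → Expr) : Expr :=
  .disj (.conj (letterE e 3) (.disj (g (succE e)) (g (sndE e))))
    (.conj (letterE e 4) (.conj (g (succE e)) (g (sndE e))))

def rightE (e : Expr) (g : Expr → Expr) : Expr :=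
  .disj (.conj (letterE e 3) (.conj (g (succE e)) (g (sndE e))))
    (.conj (letterE e 4) (.disj (g (succE e)) (g (sndE e))))

/-- The value of `e` if the truth value `c` is `1`, and `0` otherwise. -/
def selE (c e : Expr) : Expr := .sub e (.arr 2 (.sub (.const 1) c))

/-- For a leaf, a diamond or a binary connective, respectively, exactly one summand is selected. A
diamond ends where its body ends, a binary formula where its second argument ends. -/
def endStep (e : Expr) : Expr :=
  .add (.add (selE (.leq (.read e) (.const 2)) (succE e)) (selE (isDiaE e) (sndE e)))
    (selE (.conj (.leq (.const 3) (.read e)) (.leq (.read e) (.const 4))) (endE (sndE e)))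

def unsatStep (e : Expr) : Expr :=
  .disj (letterE e 2) (.disj (leftE e unsatE) (.conj (isDiaE e) (unsatE (succE e))))

def derStep (a b c : Expr) : Expr :=
  .disj (.disj (unsatE a) (unsatE b)) (.disj (.disj (letterE c 1) (rightE c (derE a b)))
    (.disj (.disj (leftE a fun a => derE a b c) (leftE b fun b => derE a b c))
      (.conj (isDiaE a) (.conj ((Expr.read a).eqn (.read b))
        (.conj ((Expr.read a).eqn (.read c)) (derE (succE a) (succE b) (succE c)))))))

def countCmd : Cmd := .loop (.read (.var 1)) (.assign 1 (succE (.var 1)))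

def squareCmd : Cmd := .down 2 (.var 5) (.assign 6 (.add (.var 6) (.var 5)))

/-- Multiples are tabulated by repeated addition up to the factor `(n + 1) ^ 2`, enough for the
outer of the two lookups in `derE`. -/
def mulCmd : Cmd := .loop (.sub (.var 6) (.var 3))
  (.seq (.put 2 (succE (.var 3)) (.add (.arr 2 (.var 3)) (.var 5)))
    (.assign 3 (succE (.var 3))))

/-- Positions are treated from right to left, so the arguments of a connective are ready before it.
-/
def parseCmd : Cmd := .down 2 (.var 1)
  (.seq (.put 0 (.var 2) (endStep (.var 2))) (.put 1 (.var 2) (unsatStep (.var 2))))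

def innerCmd : Cmd := .down 4 (.var 1) (.put 3
  (.add (.arr 2 (.add (.arr 2 (.var 2)) (.var 3))) (.var 4))
  (derStep (.var 2) (.var 3) (.var 4)))

def tableCmd : Cmd := .down 2 (.var 1) (.down 3 (.var 1) innerCmd)

def primeCmd : Cmd :=
  .seq countCmd (.seq (.assign 5 (succE (.var 1))) (.seq squareCmd (.seq mulCmd
    (.seq parseCmd (.seq tableCmd (.assign 0 (.arr 3 (.const 0))))))))

/-! ### The invariants -/

def square (n : ℕ) : ℕ := (n + 1) * (n + 1)

def cube (n : ℕ) : ℕ := (n + 1) * square n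

/-- The place of a triple of positions. -/
def idx (n i j k : ℕ) : ℕ := (n + 1) * ((n + 1) * i + j) + k

theorem le_square (n : ℕ) : n + 1 ≤ square n := by unfold square; nlinarith

theorem square_le_cube (n : ℕ) : square n ≤ cube n := by unfold cube; nlinarith [le_square n]

theorem lin_le_square {n i j : ℕ} (hi : i ≤ n) (hj : j ≤ n) : (n + 1) * i + j ≤ square n := by
  unfold square; nlinarith

theorem mul_le_cube {n j : ℕ} (hj : j ≤ square n) : (n + 1) * j ≤ cube n :=
  Nat.mul_le_mul_left _ hj

theorem lin_inj {n a b k l : ℕ} (hk : k ≤ n) (hl : l ≤ n)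
    (h : (n + 1) * a + k = (n + 1) * b + l) : a = b ∧ k = l := by
  have h1 := congrArg (· % (n + 1)) h
  have h2 := congrArg (· / (n + 1)) h
  simp only [Nat.mul_add_mod, Nat.mul_add_div (Nat.succ_pos n),
    Nat.mod_eq_of_lt (Nat.lt_succ_of_le hk), Nat.mod_eq_of_lt (Nat.lt_succ_of_le hl),
    Nat.div_eq_of_lt (Nat.lt_succ_of_le hk), Nat.div_eq_of_lt (Nat.lt_succ_of_le hl)] at h1 h2
  omega

/-- The positions are digits in base `n + 1`; the leading one needs no bound. -/
theorem idx_inj {n i j k i' j' k' : ℕ} (hj : j ≤ n) (hk : k ≤ n) (hj' : j' ≤ n) (hk' : k' ≤ n)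
    (h : idx n i j k = idx n i' j' k') : i = i' ∧ j = j' ∧ k = k' := by
  obtain ⟨h1, h2⟩ := lin_inj hk hk' h
  obtain ⟨h3, h4⟩ := lin_inj hj hj' h1
  exact ⟨h3, h4, h2⟩

/-- The number bound that the program needs. -/
structure Room (w : List ℕ) (W : ℕ) : Prop where
  le : 8 * cube w.length + 8 * w.length + 16 ≤ W
  letter_le : ∀ a ∈ w, a ≤ W

theorem Room.getD_le {w : List ℕ} {W : ℕ} (h : Room w W) (i : ℕ) : w.getD i 0 ≤ W := by
  rw [List.getD_eq_getElem?_getD]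
  rcases hi : w[i]? with _ | a
  · simp
  · simpa using h.letter_le a (List.mem_of_getElem? hi)

/-- The bounds are required at every index: truth-valued expressions are evaluated without
short-circuiting, so lookups also occur where the letter makes them irrelevant. -/
structure Tables (w : List ℕ) (σ : State) : Prop where
  n_eq : σ.var 1 = w.length
  mul_eq : ∀ j ≤ square w.length, σ.arr 2 j = (w.length + 1) * j
  mul_le : ∀ j, σ.arr 2 j ≤ cube w.length
  end_le : ∀ i, σ.arr 0 i ≤ w.length
  unsat_le : ∀ i, σ.arr 1 i ≤ 1
  der_le : ∀ i, σ.arr 3 i ≤ 1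

/-- The entries of the first two arrays are correct from position `r` on. -/
structure Parsed {Act : Type*} (name : Act → ℕ) (w : List ℕ) (r : ℕ) (σ : State) : Prop
    extends Tables w σ where
  end_eq : ∀ i ≥ r, ∀ x, At name w i x → σ.arr 0 i = i + x.size
  unsat_iff : ∀ i ≥ r, ∀ x, At name w i x → (σ.arr 1 i = 1 ↔ Unsat x)

/-- The entries of the last array are correct at the triples of positions in `D`. -/
structure Filled {Act : Type*} (name : Act → ℕ) (w : List ℕ) (D : ℕ → ℕ → ℕ → Prop) (σ : State) :
    Prop extends Parsed name w 0 σ where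
  der_iff : ∀ i j k, D i j k → ∀ x y z, At name w i x → At name w j y → At name w k z →
    (σ.arr 3 (idx w.length i j k) = 1 ↔ Der x y z)

/-! ### Evaluation of the table-filling expressions -/

section Eval

variable {Act : Type*} {name : Act → ℕ} {w : List ℕ} {W : ℕ} {σ : State}

theorem bdd_succE (hW : Room w W) {e : Expr} (he : e.Bdd w σ W) (h : e.eval w σ ≤ w.length) :
    (succE e).Bdd w σ W :=
  ⟨he, by have := hW.le; simp only [Expr.Bdd]; omega, by
    have := hW.le; simp only [Expr.eval]; omega⟩

theorem bdd_endE (hW : Room w W) {e : Expr} (he : e.Bdd w σ W) (h : e.eval w σ ≤ w.length + 1) :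
    (endE e).Bdd w σ W :=
  ⟨he, by
    have := hW.le
    have := le_square w.length
    have := square_le_cube w.length
    simp only [Fin.val_zero]; omega⟩

theorem bdd_sndE (hW : Room w W) {e : Expr} (he : e.Bdd w σ W) (h : e.eval w σ ≤ w.length) :
    (sndE e).Bdd w σ W :=
  bdd_endE hW (bdd_succE hW he h) (by simp only [succE, Expr.eval]; omega)

theorem holds_letterE (hW : Room w W) {e : Expr} (he : e.Bdd w σ W) {c : ℕ} (hc : c ≤ 16) :
    Holds w W σ (letterE e c) (w.getD (e.eval w σ) 0 = c) :=
  Holds.eqn (by have := hW.le; omega) he (by have := hW.le; simp only [Expr.Bdd]; omega)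
    (hW.getD_le _) (by have := hW.le; simp only [Expr.eval]; omega)

theorem holds_isDiaE (hW : Room w W) {e : Expr} (he : e.Bdd w σ W) :
    Holds w W σ (isDiaE e) (5 ≤ w.getD (e.eval w σ) 0) :=
  Holds.leq (by have := hW.le; omega) (by have := hW.le; simp only [Expr.Bdd]; omega) he

theorem holds_unsatE (hW : Room w W) (hσ : Tables w σ) {e : Expr} (he : e.Bdd w σ W)
    (h : e.eval w σ ≤ w.length) : Holds w W σ (unsatE e) (σ.arr 1 (e.eval w σ) = 1) :=
  Holds.arr he (by have := hW.le; simp only [Fin.val_one]; omega) hσ.unsat_le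

theorem bdd_and_eval_idx (hW : Room w W) (hσ : Tables w σ) {a b c : Expr} (ha : a.Bdd w σ W)
    (hb : b.Bdd w σ W) (hc : c.Bdd w σ W) (ha' : a.eval w σ ≤ w.length)
    (hb' : b.eval w σ ≤ w.length) (hc' : c.eval w σ ≤ w.length) :
    (Expr.add (.arr 2 (.add (.arr 2 a) b)) c).Bdd w σ W ∧
      (Expr.add (.arr 2 (.add (.arr 2 a) b)) c).eval w σ =
        idx w.length (a.eval w σ) (b.eval w σ) (c.eval w σ) ∧
      8 * idx w.length (a.eval w σ) (b.eval w σ) (c.eval w σ) + 5 ≤ W := by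
  have h0 := hW.le
  have h1 := le_square w.length
  have h2 := square_le_cube w.length
  have h3 := lin_le_square ha' hb'
  have h4 := mul_le_cube h3
  have e1 := hσ.mul_eq (a.eval w σ) (by omega)
  have e2 := hσ.mul_eq _ h3
  have v2 : ((2 : Fin 6) : ℕ) = 2 := rfl
  refine ⟨⟨⟨⟨⟨ha, ?_⟩, hb, ?_⟩, ?_⟩, hc, ?_⟩, ?_, ?_⟩ <;>
    simp only [Expr.eval, e1, e2, v2, idx] <;> omega

theorem holds_derE (hW : Room w W) (hσ : Tables w σ) {a b c : Expr} (ha : a.Bdd w σ W)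
    (hb : b.Bdd w σ W) (hc : c.Bdd w σ W) (ha' : a.eval w σ ≤ w.length)
    (hb' : b.eval w σ ≤ w.length) (hc' : c.eval w σ ≤ w.length) :
    Holds w W σ (derE a b c)
      (σ.arr 3 (idx w.length (a.eval w σ) (b.eval w σ) (c.eval w σ)) = 1) := by
  obtain ⟨h1, h2, h3⟩ := bdd_and_eval_idx hW hσ ha hb hc ha' hb' hc'
  rw [← h2] at h3 ⊢
  exact Holds.arr h1 h3 hσ.der_le

section Connective

variable (hW : Room w W) (hσ : Tables w σ) {e : Expr} {i : ℕ} (he : e.Bdd w σ W)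
  (hi : e.eval w σ = i) {x : Formula Act} (hx : At name w i x)
  (hend : ∀ x', At name w (i + 1) x' → σ.arr 0 (i + 1) = i + 1 + x'.size)
  {g : Expr → Expr} {p : ℕ → Prop}
  (hg : ∀ e' : Expr, e'.Bdd w σ W → e'.eval w σ ≤ w.length → Holds w W σ (g e') (p (e'.eval w σ)))
  {f : Formula Act → Prop} (hf : ∀ i' > i, ∀ x', At name w i' x' → (p i' ↔ f x'))

include hW hσ he hi hx hend hg hf

/-- Here `p` is what a table records at a position and `f` the property meant; they need to agree
only at positions after `i`, where both arguments lie. -/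
theorem holds_leftE : Holds w W σ (leftE e g) (Left f x) := by
  have hlt := hx.le_length
  have hpos := x.size_pos
  have h2 : 2 ≤ W := by have := hW.le; omega
  have hs := hg (succE e) (bdd_succE hW he (by omega)) (by simp only [succE, Expr.eval]; omega)
  have hr := hg (sndE e) (bdd_sndE hW he (by omega)) (hσ.end_le _)
  have l3 := holds_letterE hW he (c := 3) (by omega)
  have l4 := holds_letterE hW he (c := 4) (by omega)
  refine (Holds.disj h2 (l3.conj (hs.disj h2 hr)) (l4.conj (hs.conj hr))).congr ?_
  simp only [succE, sndE, endE, Expr.eval, hi]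
  cases x with
  | tt => simp [-List.getD_eq_getElem?_getD, hx.tt_letter, Left]
  | ff => simp [-List.getD_eq_getElem?_getD, hx.ff_letter, Left]
  | and a b =>
    rw [hend a hx.and_left, hx.and_letter, hf _ (by omega) a hx.and_left,
      hf _ (by omega) b hx.and_right]
    simp [Left]
  | or a b =>
    rw [hend a hx.or_left, hx.or_letter, hf _ (by omega) a hx.or_left,
      hf _ (by omega) b hx.or_right]
    simp [Left]
  | dia a b =>
    have h3 : 5 + name a ≠ 3 := by omega
    have h4 : 5 + name a ≠ 4 := by omega
    simp [-List.getD_eq_getElem?_getD, hx.dia_letter, Left, h3, h4]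

theorem holds_rightE : Holds w W σ (rightE e g) (Right f x) := by
  have hlt := hx.le_length
  have hpos := x.size_pos
  have h2 : 2 ≤ W := by have := hW.le; omega
  have hs := hg (succE e) (bdd_succE hW he (by omega)) (by simp only [succE, Expr.eval]; omega)
  have hr := hg (sndE e) (bdd_sndE hW he (by omega)) (hσ.end_le _)
  have l3 := holds_letterE hW he (c := 3) (by omega)
  have l4 := holds_letterE hW he (c := 4) (by omega)
  refine (Holds.disj h2 (l3.conj (hs.conj hr)) (l4.conj (hs.disj h2 hr))).congr ?_
  simp only [succE, sndE, endE, Expr.eval, hi]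
  cases x with
  | tt => simp [-List.getD_eq_getElem?_getD, hx.tt_letter, Right]
  | ff => simp [-List.getD_eq_getElem?_getD, hx.ff_letter, Right]
  | and a b =>
    rw [hend a hx.and_left, hx.and_letter, hf _ (by omega) a hx.and_left,
      hf _ (by omega) b hx.and_right]
    simp [Right]
  | or a b =>
    rw [hend a hx.or_left, hx.or_letter, hf _ (by omega) a hx.or_left,
      hf _ (by omega) b hx.or_right]
    simp [Right]
  | dia a b =>
    have h3 : 5 + name a ≠ 3 := by omega
    have h4 : 5 + name a ≠ 4 := by omega
    simp [-List.getD_eq_getElem?_getD, hx.dia_letter, Right, h3, h4]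

end Connective

/-- Selection without branching: entry `0` or `1` of the multiples is subtracted, that is `0` or `n
+ 1`, and the latter exceeds the value of `e`. -/
theorem bdd_and_eval_selE (hW : Room w W) (hσ : Tables w σ) {c e : Expr} {p : Prop}
    (hc : Holds w W σ c p) (he : e.Bdd w σ W) (he' : e.eval w σ ≤ w.length) :
    (selE c e).Bdd w σ W ∧ (p → (selE c e).eval w σ = e.eval w σ) ∧
      (¬ p → (selE c e).eval w σ = 0) := by
  have h0 := hW.le
  have h1 := le_square w.length
  obtain ⟨bc, lc, ec⟩ := hc
  have v2 : ((2 : Fin 6) : ℕ) = 2 := rfl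
  refine ⟨⟨he, ⟨?_, bc⟩, ?_⟩, fun hp => ?_, fun hp => ?_⟩
  · simp only [Expr.Bdd]; omega
  · simp only [Expr.eval, v2]; omega
  · have := hσ.mul_eq 0 (Nat.zero_le _)
    simp [selE, Expr.eval, ec.2 hp, this]
  · have hz : c.eval w σ = 0 := by
      have : c.eval w σ ≠ 1 := fun h => hp (ec.1 h)
      omega
    have := hσ.mul_eq 1 (by omega)
    simp only [selE, Expr.eval, hz, Nat.sub_zero, this]
    omega

theorem bdd_and_eval_endStep (hW : Room w W) (hσ : Tables w σ) {e : Expr} {i : ℕ}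
    (he : e.Bdd w σ W) (hi : e.eval w σ = i) {x : Formula Act} (hx : At name w i x)
    (hend : ∀ i' > i, ∀ x', At name w i' x' → σ.arr 0 i' = i' + x'.size) :
    (endStep e).Bdd w σ W ∧ (endStep e).eval w σ = i + x.size := by
  have h0 := hW.le
  have hlt := hx.le_length
  have hpos := x.size_pos
  have h2 : 2 ≤ W := by omega
  have hc : ∀ c ≤ 16, (Expr.const c).Bdd w σ W := fun c hc => by simp only [Expr.Bdd]; omega
  have hleaf := Holds.leq (a := .read e) (b := .const 2) h2 he (hc 2 (by omega))
  have hbin := (Holds.leq (a := .const 3) (b := .read e) h2 (hc 3 (by omega)) he).conj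
    (Holds.leq (a := .read e) (b := .const 4) h2 he (hc 4 (by omega)))
  have hdia := holds_isDiaE hW he
  obtain ⟨b1, t1, f1⟩ := bdd_and_eval_selE hW hσ hleaf
    (bdd_succE hW he (by omega)) (by simp only [succE, Expr.eval]; omega)
  obtain ⟨b2, t2, f2⟩ := bdd_and_eval_selE hW hσ hdia
    (bdd_sndE hW he (by omega)) (hσ.end_le _)
  obtain ⟨b3, t3, f3⟩ := bdd_and_eval_selE hW hσ hbin
    (bdd_endE hW (bdd_sndE hW he (by omega)) ((hσ.end_le _).trans (Nat.le_succ _))) (hσ.end_le _)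
  have e1 : (succE e).eval w σ = i + 1 := by simp only [succE, Expr.eval, hi]
  have e2 : (sndE e).eval w σ = σ.arr 0 (i + 1) := by simp only [sndE, endE, Expr.eval, e1]
  have e3 : (endE (sndE e)).eval w σ = σ.arr 0 (σ.arr 0 (i + 1)) := by
    simp only [endE, Expr.eval, e2]
  rw [e1] at t1
  rw [e2] at t2
  rw [e3] at t3
  have key : (endStep e).eval w σ = i + x.size := by
    simp only [Expr.eval, hi] at t1 f1 t2 f2 t3 f3
    simp only [endStep, Expr.eval]
    cases x with
    | tt =>
      rw [hx.tt_letter] at t1 f2 f3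
      rw [t1 (by omega), f2 (by omega), f3 (by omega)]
      simp [size]
    | ff =>
      rw [hx.ff_letter] at t1 f2 f3
      rw [t1 (by omega), f2 (by omega), f3 (by omega)]
      simp [size]
    | and a b =>
      rw [hx.and_letter] at t3 f2 f1
      rw [t3 (by omega), f2 (by omega), f1 (by omega), hend _ (by omega) a hx.and_left,
        hend _ (by omega) b hx.and_right]
      simp only [size]; omega
    | or a b =>
      rw [hx.or_letter] at t3 f2 f1
      rw [t3 (by omega), f2 (by omega), f1 (by omega), hend _ (by omega) a hx.or_left,
        hend _ (by omega) b hx.or_right]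
      simp only [size]; omega
    | dia a b =>
      rw [hx.dia_letter] at f3 t2 f1
      rw [f3 (by omega), t2 (by omega), f1 (by omega), hend _ (by omega) b hx.dia_sub]
      simp only [size]; omega
  -- The partial sums are at most the total `i + x.size`, hence at most the length of the word.
  have key' := key
  simp only [endStep, Expr.eval] at key'
  exact ⟨⟨⟨b1, b2, by omega⟩, b3, by simp only [Expr.eval]; omega⟩, key⟩

theorem holds_unsatStep (hW : Room w W) (hσ : Tables w σ) {e : Expr} {i : ℕ}
    (he : e.Bdd w σ W) (hi : e.eval w σ = i) {x : Formula Act} (hx : At name w i x)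
    (hend : ∀ i' > i, ∀ x', At name w i' x' → σ.arr 0 i' = i' + x'.size)
    (hun : ∀ i' > i, ∀ x', At name w i' x' → (σ.arr 1 i' = 1 ↔ Unsat x')) :
    Holds w W σ (unsatStep e) (Unsat x) := by
  have h2 : 2 ≤ W := by have := hW.le; omega
  have hlt := hx.le_length
  have hpos := x.size_pos
  have h1 := holds_letterE hW he (c := 2) (by omega)
  have hl := holds_leftE hW hσ he hi hx (hend _ (Nat.lt_succ_self i))
    (fun e' h h' => holds_unsatE hW hσ h h') hun
  have hd := (holds_isDiaE hW he).conj
    (holds_unsatE hW hσ (bdd_succE hW he (by omega)) (by simp only [succE, Expr.eval]; omega))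
  refine (h1.disj h2 (hl.disj h2 hd)).congr ?_
  rw [unsat_iff]
  simp only [succE, Expr.eval, hi]
  refine or_congr ?_ (or_congr Iff.rfl ?_)
  · cases x with
    | tt => simp [-List.getD_eq_getElem?_getD, hx.tt_letter]
    | ff => simp [-List.getD_eq_getElem?_getD, hx.ff_letter]
    | and a b => simp [-List.getD_eq_getElem?_getD, hx.and_letter]
    | or a b => simp [-List.getD_eq_getElem?_getD, hx.or_letter]
    | dia a b =>
      rw [hx.dia_letter]
      simp only [reduceCtorEq, iff_false]; omega
  · cases x with
    | tt => simp [-List.getD_eq_getElem?_getD, hx.tt_letter]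
    | ff => simp [-List.getD_eq_getElem?_getD, hx.ff_letter]
    | and a b => simp [-List.getD_eq_getElem?_getD, hx.and_letter]
    | or a b => simp [-List.getD_eq_getElem?_getD, hx.or_letter]
    | dia a b => simp [-List.getD_eq_getElem?_getD, hx.dia_letter, hun _ (Nat.lt_succ_self i) _ hx.dia_sub]

/-- The hypotheses `h₁` to `h₄` cover exactly the table entries that the recurrence `der_iff`
consults. -/
theorem holds_derStep (hname : Function.Injective name) (hW : Room w W)
    (hσ : Parsed name w 0 σ) {a b c : Expr} {i j k : ℕ}
    (ha : a.Bdd w σ W) (hb : b.Bdd w σ W) (hc : c.Bdd w σ W) (hi : a.eval w σ = i)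
    (hj : b.eval w σ = j) (hk : c.eval w σ = k) {x y z : Formula Act} (hx : At name w i x)
    (hy : At name w j y) (hz : At name w k z)
    (h₁ : ∀ k' > k, ∀ z', At name w k' z' → (σ.arr 3 (idx w.length i j k') = 1 ↔ Der x y z'))
    (h₂ : ∀ i' > i, ∀ x', At name w i' x' → (σ.arr 3 (idx w.length i' j k) = 1 ↔ Der x' y z))
    (h₃ : ∀ j' > j, ∀ y', At name w j' y' → (σ.arr 3 (idx w.length i j' k) = 1 ↔ Der x y' z))
    (h₄ : ∀ x' y' z', At name w (i + 1) x' → At name w (j + 1) y' → At name w (k + 1) z' →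
      (σ.arr 3 (idx w.length (i + 1) (j + 1) (k + 1)) = 1 ↔ Der x' y' z')) :
    Holds w W σ (derStep a b c) (Der x y z) := by
  have h0 := hW.le
  have h2 : 2 ≤ W := by omega
  have hσ' := hσ.toTables
  have lx := hx.le_length
  have px := x.size_pos
  have ly := hy.le_length
  have py := y.size_pos
  have lz := hz.le_length
  have pz := z.size_pos
  have ux := (holds_unsatE hW hσ' ha (by omega)).congr
    (hi ▸ hσ.unsat_iff i (Nat.zero_le _) x hx)
  have uy := (holds_unsatE hW hσ' hb (by omega)).congr
    (hj ▸ hσ.unsat_iff j (Nat.zero_le _) y hy)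
  have hR := holds_rightE (g := derE a b) hW hσ' hc hk hz
    (hσ.end_eq _ (Nat.zero_le _))
    (p := fun k' => σ.arr 3 (idx w.length (a.eval w σ) (b.eval w σ) k') = 1)
    (fun e' h h' => holds_derE hW hσ' ha hb h (by omega) (by omega) h') (by rw [hi, hj]; exact h₁)
  have hLx := holds_leftE (g := fun a => derE a b c) hW hσ' ha hi hx
    (hσ.end_eq _ (Nat.zero_le _))
    (p := fun i' => σ.arr 3 (idx w.length i' (b.eval w σ) (c.eval w σ)) = 1)
    (fun e' h h' => holds_derE hW hσ' h hb hc h' (by omega) (by omega)) (by rw [hj, hk]; exact h₂)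
  have hLy := holds_leftE (g := fun b => derE a b c) hW hσ' hb hj hy
    (hσ.end_eq _ (Nat.zero_le _))
    (p := fun j' => σ.arr 3 (idx w.length (a.eval w σ) j' (c.eval w σ)) = 1)
    (fun e' h h' => holds_derE hW hσ' ha h hc (by omega) h' (by omega)) (by rw [hi, hk]; exact h₃)
  have hT := holds_letterE hW hc (c := 1) (by omega)
  have hD := holds_derE hW hσ' (bdd_succE hW ha (by omega)) (bdd_succE hW hb (by omega))
    (bdd_succE hW hc (by omega)) (by simp only [succE, Expr.eval]; omega)
    (by simp only [succE, Expr.eval]; omega) (by simp only [succE, Expr.eval]; omega)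
  have q1 := Holds.eqn (a := .read a) (b := .read b) h2 ha hb (hW.getD_le _) (hW.getD_le _)
  have q2 := Holds.eqn (a := .read a) (b := .read c) h2 ha hc (hW.getD_le _) (hW.getD_le _)
  refine ((ux.disj h2 uy).disj h2 ((hT.disj h2 hR).disj h2 ((hLx.disj h2 hLy).disj h2
    ((holds_isDiaE hW ha).conj (q1.conj (q2.conj hD)))))).congr ?_
  rw [der_iff]
  simp only [succE, Expr.eval, hi, hj, hk]
  refine or_congr Iff.rfl (or_congr (or_congr ?_ Iff.rfl) (or_congr Iff.rfl ?_))
  · cases z with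
    | tt => simp [-List.getD_eq_getElem?_getD, hz.tt_letter]
    | ff => simp [-List.getD_eq_getElem?_getD, hz.ff_letter]
    | and a b => simp [-List.getD_eq_getElem?_getD, hz.and_letter]
    | or a b => simp [-List.getD_eq_getElem?_getD, hz.or_letter]
    | dia a b =>
      rw [hz.dia_letter]
      simp only [reduceCtorEq, iff_false]; omega
  · constructor
    -- Only the letter of `x` is tested for being a diamond; equality of letters forces the same on
    -- `y` and `z`.
    · rintro ⟨g1, g2, g3, g4⟩
      cases x with
      | tt => rw [hx.tt_letter] at g1; omega
      | ff => rw [hx.ff_letter] at g1; omega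
      | and a b => rw [hx.and_letter] at g1; omega
      | or a b => rw [hx.or_letter] at g1; omega
      | dia a x =>
        rw [hx.dia_letter] at g2 g3
        cases y with
        | tt => rw [hy.tt_letter] at g2; omega
        | ff => rw [hy.ff_letter] at g2; omega
        | and a b => rw [hy.and_letter] at g2; omega
        | or a b => rw [hy.or_letter] at g2; omega
        | dia b y =>
          cases z with
          | tt => rw [hz.tt_letter] at g3; omega
          | ff => rw [hz.ff_letter] at g3; omega
          | and a b => rw [hz.and_letter] at g3; omega
          | or a b => rw [hz.or_letter] at g3; omega
          | dia c z =>
            rw [hy.dia_letter] at g2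
            rw [hz.dia_letter] at g3
            -- Equal letters give equal actions because the naming is injective.
            obtain rfl : a = b := hname (by omega)
            obtain rfl : a = c := hname (by omega)
            exact ⟨a, x, y, z, rfl, rfl, rfl, (h₄ x y z hx.dia_sub hy.dia_sub hz.dia_sub).1 g4⟩
    · rintro ⟨a, x, y, z, rfl, rfl, rfl, h⟩
      refine ⟨?_, ?_, ?_, (h₄ x y z hx.dia_sub hy.dia_sub hz.dia_sub).2 h⟩
      · rw [hx.dia_letter]; omega
      · rw [hx.dia_letter, hy.dia_letter]
      · rw [hx.dia_letter, hz.dia_letter]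

end Eval

end Program

end SimLogic

namespace SimLogic

open RAM RAM.Expr Formula

namespace Program

/-! ### Correctness of the parts of the program -/

theorem bdd_var {w : List ℕ} {W : ℕ} {σ : State} (v : ℕ) : (Expr.var v).Bdd w σ W := trivial

section Phases

variable {Act : Type*} {name : Act → ℕ} {w : List ℕ} {W : ℕ} {σ : State}

theorem does_countCmd (hW : Room w W) (hpos : ∀ a ∈ w, 0 < a) {Q : State → Prop}
    (hQ : ∀ σ : State, σ.var 1 = w.length → σ.var 3 = 0 → σ.var 6 = 0 →
      (∀ k i, σ.arr k i = 0) → Q σ) :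
    Does w W countCmd ⟨fun _ => 0, fun _ _ => 0⟩ (12 * w.length + 4) Q := by
  have h0 := hW.le
  refine Does.mono (Q := Q) (Does.loop (T := 6) (r := w.length) hW.letter_le
    (fun r σ => σ.var 1 + r = w.length ∧ σ.var 3 = 0 ∧ σ.var 6 = 0 ∧ ∀ k i, σ.arr k i = 0)
    ?_ ?_ ?_) ?_ fun _ h => h
  · rintro σ ⟨h1, h2⟩
    refine ⟨trivial, ?_, hQ σ (by omega) h2.1 h2.2.1 h2.2.2⟩
    simp only [Expr.eval]
    exact List.getD_eq_default _ _ (by omega)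
  · rintro r σ ⟨h1, h2, h3, h4⟩
    refine ⟨trivial, ?_, ?_⟩
    · have hlt : σ.var 1 < w.length := by omega
      simp only [Expr.eval]
      rw [List.getD_eq_getElem _ _ hlt]
      exact (hpos _ (List.getElem_mem hlt)).ne'
    · refine Does.assign hW.letter_le (bdd_succE hW trivial ?_) ?_
      · simp only [Expr.eval]; omega
      · refine ⟨?_, by simpa using h2, by simpa using h3, by simpa using h4⟩
        simp [succE, Expr.eval]; omega
  · simp
  · simp only [Expr.len]; omega

theorem does_squareCmd (hW : Room w W) (h1 : σ.var 1 = w.length) (h3 : σ.var 3 = 0)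
    (h5 : σ.var 5 = w.length + 1) (h6 : σ.var 6 = 0) (ha : ∀ k i, σ.arr k i = 0)
    {Q : State → Prop} (hQ : ∀ σ : State, σ.var 1 = w.length → σ.var 3 = 0 →
      σ.var 5 = w.length + 1 → σ.var 6 = square w.length → (∀ k i, σ.arr k i = 0) → Q σ) :
    Does w W squareCmd σ (18 * w.length + 30) Q := by
  have h0 := hW.le
  have hs := square_le_cube w.length
  refine Does.mono (Q := Q) (Does.down (T := 7) (r := w.length + 1) hW.letter_le (by omega) (bdd_var
      5) h5
    (fun r σ => σ.var 1 = w.length ∧ σ.var 3 = 0 ∧ σ.var 5 = w.length + 1 ∧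
      σ.var 6 + (w.length + 1) * r = square w.length ∧ ∀ k i, σ.arr k i = 0) ?_ ?_ ?_) ?_ fun _ h =>
          h
  · exact ⟨by simpa using h1, by simpa using h3, by simpa using h5, by simp [h6, square], ha⟩
  · rintro i σ ⟨g1, g3, g5, g6, ga⟩ - -
    rw [Nat.mul_succ] at g6
    refine Does.assign hW.letter_le ⟨trivial, trivial, ?_⟩ ?_
    · simp [Expr.eval, g5]; omega
    · refine ⟨⟨by simpa using g1, by simpa using g3, by simpa using g5, ?_, ga⟩, by simp⟩
      simp [Expr.eval, g5]; omega
  · rintro σ ⟨g1, g3, g5, g6, ga⟩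
    exact hQ σ g1 g3 g5 (by simpa using g6) ga
  · simp only [Expr.len]; omega

theorem does_mulCmd (hW : Room w W) (h1 : σ.var 1 = w.length) (h3 : σ.var 3 = 0)
    (h5 : σ.var 5 = w.length + 1) (h6 : σ.var 6 = square w.length) (ha : ∀ k i, σ.arr k i = 0)
    {Q : State → Prop} (hQ : ∀ σ : State, Tables w σ → Q σ) :
    Does w W mulCmd σ (50 * square w.length + 10) Q := by
  have h0 := hW.le
  have hs := square_le_cube w.length
  have v2 : ((2 : Fin 6) : ℕ) = 2 := rfl
  -- The body takes `27` steps; `40` is a round bound.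
  refine Does.mono (Q := Q) (Does.loop (T := 40) (r := square w.length) hW.letter_le
    (fun r σ => σ.var 1 = w.length ∧ σ.var 5 = w.length + 1 ∧ σ.var 6 = square w.length ∧
      σ.var 3 + r = square w.length ∧ (∀ k i, k ≠ 2 → σ.arr k i = 0) ∧
      ∀ j, σ.arr 2 j = if j ≤ σ.var 3 then (w.length + 1) * j else 0) ?_ ?_ ?_) ?_ fun _ h => h
  · rintro σ ⟨g1, g5, g6, g3, ga, g2⟩
    refine ⟨⟨trivial, trivial⟩, by simp only [Expr.eval]; omega, hQ σ ?_⟩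
    refine ⟨g1, fun j hj => ?_, fun j => ?_, ?_, ?_, ?_⟩
    · rw [g2, if_pos (by omega)]
    · rw [g2]
      split_ifs with h
      · exact mul_le_cube (by omega)
      · exact Nat.zero_le _
    all_goals exact fun i => by rw [ga _ _ (by decide)]; exact Nat.zero_le _
  · rintro r σ ⟨g1, g5, g6, g3, ga, g2⟩
    refine ⟨⟨trivial, trivial⟩, by simp only [Expr.eval]; omega, ?_⟩
    have hc : (w.length + 1) * (σ.var 3 + 1) ≤ cube w.length := mul_le_cube (by omega)
    rw [Nat.mul_succ] at hc
    have e2 : σ.arr 2 (σ.var 3) = (w.length + 1) * σ.var 3 := by rw [g2, if_pos le_rfl]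
    have hb : ∀ σ : State, σ.var 3 + 1 ≤ square w.length → (succE (.var 3)).Bdd w σ W :=
      fun σ h => ⟨trivial, by simp only [Expr.Bdd]; omega, by simp only [Expr.eval]; omega⟩
    refine Does.mono (Does.seq (T' := 6) (Does.put (k := 2) (e := .add (.arr 2 (.var 3)) (.var 5))
        hW.letter_le
      (hb σ (by omega)) ?_ ⟨⟨trivial, ?_⟩, trivial, ?_⟩ (Does.assign hW.letter_le (hb _ ?_) ?_))) ?_
          fun _ h => h
    · simp only [succE, Expr.eval, v2]; omega
    · simp only [Expr.eval, v2]; omega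
    · simp only [Expr.eval, e2, g5]; omega
    · simp only [State.setArr_var]; omega
    · simp only [succE, Expr.eval, e2, g5, State.setArr_var]
      refine ⟨by simpa using g1, by simpa using g5, by simpa using g6, by simp; omega, ?_, ?_⟩
      · intro k i hk
        simp [hk, ga]
      · intro j
        simp only [State.setVar_arr, State.setArr_arr, State.setVar_var, true_and, if_true]
        by_cases hj : j = σ.var 3 + 1
        · rw [if_pos hj, if_pos (by omega), hj, Nat.mul_succ]
        · rw [if_neg hj, g2]
          by_cases hj' : j ≤ σ.var 3
          · rw [if_pos hj', if_pos (by omega)]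
          · rw [if_neg hj', if_neg (by omega)]
    · simp only [succE, Expr.len]; omega
  · refine ⟨h1, h5, h6, by omega, fun k i _ => ha k i, fun j => ?_⟩
    rw [ha]
    split_ifs with h
    · obtain rfl : j = 0 := by omega
      rfl
    · rfl
  · simp only [Expr.len]; omega

theorem Tables.setVar (h : Tables w σ) {v a : ℕ} (hv : v ≠ 1) : Tables w (σ.setVar v a) :=
  ⟨by simp [hv.symm, h.n_eq], h.mul_eq, h.mul_le, h.end_le, h.unsat_le, h.der_le⟩

theorem Parsed.setVar {r : ℕ} (h : Parsed name w r σ) {v a : ℕ} (hv : v ≠ 1) :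
    Parsed name w r (σ.setVar v a) :=
  ⟨Tables.setVar h.toTables hv, h.end_eq, h.unsat_iff⟩

theorem Filled.setVar {D : ℕ → ℕ → ℕ → Prop} (h : Filled name w D σ) {v a : ℕ} (hv : v ≠ 1) :
    Filled name w D (σ.setVar v a) :=
  ⟨Parsed.setVar h.toParsed hv, h.der_iff⟩

/-- A third position outside the word carries no formula, so only `k < w.length` matters. This turns
"done from `(i, j + 1, 0)`" into "done from `(i, j, n)`", the start of an inner loop. -/
theorem Filled.mono {D D' : ℕ → ℕ → ℕ → Prop} (h : Filled name w D σ)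
    (hD : ∀ i j k, k < w.length → D' i j k → D i j k) : Filled name w D' σ :=
  ⟨h.toParsed, fun i j k hd x y z hx hy hz => h.der_iff i j k
    (hD i j k (by have := hz.le_length; have := z.size_pos; omega) hd) x y z hx hy hz⟩

theorem does_parseCmd (hW : Room w W) (hat : ∀ i < w.length, ∃ x, At name w i x)
    (hσ : Tables w σ) {Q : State → Prop} (hQ : ∀ σ : State, Parsed name w 0 σ → Q σ) :
    Does w W parseCmd σ (1000 * w.length + 10) Q := by
  have h0 := hW.le
  have h1 := le_square w.length
  have h2 := square_le_cube w.length
  -- The body is loop-free, so its fixed code length is its running time; that `800` suffices is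
  -- checked by evaluation.
  refine Does.mono (Q := Q) (Does.down (T := 800) (r := w.length) hW.letter_le (by omega) (bdd_var
      1) hσ.n_eq
    (fun r σ => Parsed name w r σ) ?_ ?_ hQ) ?_ fun _ h => h
  · refine ⟨Tables.setVar hσ (by decide), ?_, ?_⟩ <;>
    · intro i hi x hx
      have := hx.le_length
      have := x.size_pos
      omega
  · intro i σ hσ _ hi
    replace hσ := Parsed.setVar hσ (v := 2) (a := i) (by decide)
    have hv : (σ.setVar 2 i).var 2 = i := by simp
    generalize σ.setVar 2 i = σ at hσ hv
    -- Correctness is needed for every `x` read at `i`; the one that exists, `x₀`, supplies the size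
    -- bounds.
    have hE : ∀ x, At name w i x → _ := fun x hx => bdd_and_eval_endStep hW hσ.toTables
      (e := .var 2) trivial hv hx fun i' hi' x' hx' => hσ.end_eq i' hi' x' hx'
    obtain ⟨x₀, hx₀⟩ := hat i hi
    have hvE : (Expr.var 2).eval w σ = i := hv
    refine Does.mono (T := 2 + (endStep (.var 2)).len + 6 + (2 + (unsatStep (.var 2)).len + 6))
        (Does.seq (Does.put (k := 0) hW.letter_le (bdd_var 2) ?_ (hE x₀ hx₀).1 ?_)) (by decide) fun
        _ h => h
    · simp only [hvE, Fin.val_zero]; omega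
    rw [hvE]
    set a := (endStep (.var 2)).eval w σ 
    have hσ' : Tables w (σ.setArr 0 i a) := by
      refine ⟨hσ.n_eq, by simpa using hσ.mul_eq, by simpa using hσ.mul_le, fun i' => ?_,
        by simpa using hσ.unsat_le, by simpa using hσ.der_le⟩
      simp only [State.setArr_arr, true_and]
      split_ifs
      · rw [(hE x₀ hx₀).2]; exact hx₀.le_length
      · exact hσ.end_le i'
    have hend : ∀ i' ≥ i, ∀ x', At name w i' x' →
        (σ.setArr 0 i a).arr 0 i' = i' + x'.size := by
      intro i' hi' x' hx'
      simp only [State.setArr_arr, true_and]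
      split_ifs with hc
      · subst hc; exact (hE x' hx').2
      · exact hσ.end_eq i' (by omega) x' hx'
    have hun : ∀ i' > i, ∀ x', At name w i' x' →
        ((σ.setArr 0 i a).arr 1 i' = 1 ↔ Unsat x') := by
      intro i' hi' x' hx'
      simpa using hσ.unsat_iff i' hi' x' hx'
    have hv' : (σ.setArr 0 i a).var 2 = i := hv
    generalize σ.setArr 0 i a = σ at hσ' hend hun hv'
    have hU : ∀ x, At name w i x → _ := fun x hx => holds_unsatStep hW hσ' (e := .var 2)
      trivial hv' hx (fun i' hi' => hend i' hi'.le) hun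
    have hvE' : (Expr.var 2).eval w σ = i := hv'
    refine Does.mono (T := 2 + (unsatStep (.var 2)).len + 6) (Does.put (k := 1) hW.letter_le
        (bdd_var 2) ?_ (hU x₀ hx₀).1 ?_) le_rfl fun _ h => h
    · simp only [hvE', Fin.val_one]; omega
    rw [hvE']
    refine ⟨⟨⟨hσ'.n_eq, by simpa using hσ'.mul_eq, by simpa using hσ'.mul_le,
      by simpa using hσ'.end_le, fun i' => ?_, by simpa using hσ'.der_le⟩,
      by simpa using hend, fun i' hi' x' hx' => ?_⟩, hv'⟩
    · simp only [State.setArr_arr, true_and]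
      split_ifs
      · exact (hU x₀ hx₀).2.1
      · exact hσ'.unsat_le i'
    · simp only [State.setArr_arr, true_and]
      split_ifs with hc
      · subst hc; exact (hU x' hx').2.2
      · exact hun i' (by omega) x' hx'
  · simp only [Expr.len]; omega

/-- The triples that come after the first three numbers in the order of the computation. -/
def Done (i j k i' j' k' : ℕ) : Prop := i < i' ∨ i' = i ∧ (j < j' ∨ j' = j ∧ k ≤ k')

/-- Every triple consulted by the recurrence is lexicographically later than `(i, j, k)`, hence
already filled. -/
theorem does_put_derStep (hname : Function.Injective name) (hW : Room w W)
    (hat : ∀ i < w.length, ∃ x, At name w i x) {i j k : ℕ} (hi : i < w.length)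
    (hj : j < w.length) (hk : k < w.length) (hσ : Filled name w (Done i j (k + 1)) σ)
    (h2 : σ.var 2 = i) (h3 : σ.var 3 = j) (h4 : σ.var 4 = k) :
    Does w W (.put 3 (.add (.arr 2 (.add (.arr 2 (.var 2)) (.var 3))) (.var 4))
      (derStep (.var 2) (.var 3) (.var 4))) σ 2000
      fun σ' => Filled name w (Done i j k) σ' ∧ σ'.var 2 = i ∧ σ'.var 3 = j ∧ σ'.var 4 = k := by
  have e2 : (Expr.var 2).eval w σ = i := h2
  have e3 : (Expr.var 3).eval w σ = j := h3
  have e4 : (Expr.var 4).eval w σ = k := h4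
  have hD : ∀ x y z, At name w i x → At name w j y → At name w k z → _ := fun x y z hx hy hz =>
    holds_derStep hname hW hσ.toParsed (a := .var 2) (b := .var 3) (c := .var 4) trivial trivial
      trivial h2 h3 h4 hx hy hz
      (fun k' hk' z' hz' => hσ.der_iff i j k' (.inr ⟨rfl, .inr ⟨rfl, hk'⟩⟩) x y z' hx hy hz')
      (fun i' hi' x' hx' => hσ.der_iff i' j k (.inl hi') x' y z hx' hy hz)
      (fun j' hj' y' hy' => hσ.der_iff i j' k (.inr ⟨rfl, .inl hj'⟩) x y' z hx hy' hz)
      (fun x' y' z' hx' hy' hz' => hσ.der_iff _ _ _ (.inl (Nat.lt_succ_self i)) x' y' z' hx' hy'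
        hz')
  obtain ⟨x₀, hx₀⟩ := hat i hi
  obtain ⟨y₀, hy₀⟩ := hat j hj
  obtain ⟨z₀, hz₀⟩ := hat k hk
  have h₀ := hD x₀ y₀ z₀ hx₀ hy₀ hz₀
  obtain ⟨b1, b2, b3⟩ := bdd_and_eval_idx hW hσ.toTables (a := .var 2) (b := .var 3) (c := .var 4)
    trivial trivial trivial (by omega) (by omega) (by omega)
  refine Does.mono (T := 20 + (derStep (.var 2) (.var 3) (.var 4)).len + 6) (Does.put (k := 3)
      hW.letter_le b1 (by rw [b2]; exact b3) h₀.1 ?_) (by decide) fun _ h => h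
  rw [b2, e2, e3, e4]
  set a := (derStep (.var 2) (.var 3) (.var 4)).eval w σ with ha
  refine ⟨⟨⟨⟨hσ.n_eq, by simpa using hσ.mul_eq, by simpa using hσ.mul_le,
    by simpa using hσ.end_le, by simpa using hσ.unsat_le, fun i' => ?_⟩,
    by simpa using hσ.end_eq, by simpa using hσ.unsat_iff⟩, ?_⟩, h2, h3, h4⟩
  · simp only [State.setArr_arr, true_and]
    split_ifs
    · exact h₀.2.1
    · exact hσ.der_le i'
  · intro i' j' k' hd x y z hx hy hz
    have ly := hy.le_length
    have lz := hz.le_length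
    simp only [State.setArr_arr, true_and]
    split_ifs with hc
    -- By injectivity of the indexing, the write affects this triple only.
    · obtain ⟨rfl, rfl, rfl⟩ := idx_inj (by omega) (by omega) (by omega) (by omega) hc
      exact (hD x y z hx hy hz).2.2
    · refine hσ.der_iff i' j' k' ?_ x y z hx hy hz
      rcases hd with h | ⟨rfl, h | ⟨rfl, h⟩⟩
      · exact .inl h
      · exact .inr ⟨rfl, .inl h⟩
      · refine .inr ⟨rfl, .inr ⟨rfl, ?_⟩⟩
        rcases h.eq_or_lt with rfl | h
        · exact (hc rfl).elim
        · exact h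

theorem does_innerCmd (hname : Function.Injective name) (hW : Room w W)
    (hat : ∀ i < w.length, ∃ x, At name w i x) {i j : ℕ} (hi : i < w.length)
    (hj : j < w.length) (hσ : Filled name w (Done i (j + 1) 0) σ)
    (h2 : σ.var 2 = i) (h3 : σ.var 3 = j) :
    Does w W innerCmd σ (2011 * w.length + 7)
      fun σ' => (Filled name w (Done i j 0) σ' ∧ σ'.var 2 = i) ∧ σ'.var 3 = j := by
  have h0 := hW.le
  refine Does.mono (T := w.length * (2000 + 11) + 2 + 5) (Q := fun σ' => (Filled name w (Done i j 0)
      σ' ∧ σ'.var 2 = i) ∧ σ'.var 3 = j) (Does.down (r := w.length) hW.letter_le (by omega) (bdd_var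
      1) hσ.n_eq
    (fun r σ => Filled name w (Done i j r) σ ∧ σ.var 2 = i ∧ σ.var 3 = j) ?_ ?_ ?_) ?_ fun _ h => h
  · refine ⟨(Filled.setVar hσ (by decide)).mono fun i' j' k' hk' hd => ?_, by simpa using h2,
      by simpa using h3⟩
    unfold Done at *
    omega
  · rintro k σ ⟨hσ, g2, g3⟩ _ hk
    exact (does_put_derStep hname hW hat hi hj hk (Filled.setVar hσ (by decide)) (by simpa using g2)
      (by simpa using g3) (by simp)).mono le_rfl fun σ' h => ⟨⟨h.1, h.2.1, h.2.2.1⟩, h.2.2.2⟩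
  · exact fun σ h => ⟨⟨h.1, h.2.1⟩, h.2.2⟩
  · omega

theorem does_tableCmd (hname : Function.Injective name) (hW : Room w W)
    (hat : ∀ i < w.length, ∃ x, At name w i x) (hσ : Parsed name w 0 σ) {Q : State → Prop}
    (hQ : ∀ σ : State, Filled name w (Done 0 0 0) σ → Q σ) :
    Does w W tableCmd σ (w.length * (w.length * (2011 * w.length + 7 + 11) + 7 + 11) + 7) Q := by
  have h0 := hW.le
  refine Does.down (r := w.length) hW.letter_le (by omega) (bdd_var 1) hσ.n_eq
    (fun r σ => Filled name w (Done r 0 0) σ) ?_ ?_ hQ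
  · refine ⟨Parsed.setVar hσ (by decide), fun i' j' k' hd x y z hx => ?_⟩
    have := hx.le_length
    have := x.size_pos
    unfold Done at hd
    omega
  · intro i σ hσ _ hi
    refine Does.down (r := w.length) hW.letter_le (by omega) (bdd_var 1) (by simpa [Expr.eval] using
        hσ.n_eq)
      (fun r σ => Filled name w (Done i r 0) σ ∧ σ.var 2 = i) ?_ ?_ ?_
    · refine ⟨⟨Parsed.setVar (Parsed.setVar hσ.toParsed (by decide)) (by decide),
        fun i' j' k' hd x y z hx hy hz => hσ.der_iff i' j' k' ?_ x y z hx hy hz⟩, by simp⟩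
      have := hy.le_length
      have := y.size_pos
      unfold Done at *
      omega
    · rintro j σ ⟨hσ, g2⟩ _ hj
      exact does_innerCmd hname hW hat hi hj (Filled.setVar hσ (by decide)) (by simpa using g2)
        (by simp)
    · exact fun σ h => h

theorem does_primeCmd (hname : Function.Injective name) {φ : Formula Act} {W : ℕ}
    (hW : Room (φ.code name) W) :
    Does (φ.code name) W primeCmd ⟨fun _ => 0, fun _ _ => 0⟩ (100000 * φ.size ^ 3)
      fun σ => σ.var 0 ≤ 1 ∧ (σ.var 0 = 1 ↔ φ.Prime) := by
  set w := φ.code name with hw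
  have hn : w.length = φ.size := Formula.length_code φ
  have hat : ∀ i < w.length, ∃ x, At name w i x := fun i hi =>
    (at_zero φ).exists_at (Nat.zero_le i) (by omega)
  have h0 := hW.le
  have h1 := le_square w.length
  have h2 := square_le_cube w.length
  refine Does.mono (T := 12 * w.length + 4 + (6 + (18 * w.length + 30 + (50 * square w.length + 10 +
      (1000 * w.length + 10 + (w.length * (w.length * (2011 * w.length + 7 + 11) + 7 + 11) + 7 +
      9)))))) (Does.seq (does_countCmd hW (fun a ha => pos_of_mem_code ha) ?_)) ?_ fun _ h => h
  · intro σ n1 n3 n6 na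
    refine Does.seq (Does.assign (e := succE (.var 1)) hW.letter_le (bdd_succE hW trivial n1.le) ?_)
    have e1 : (succE (.var 1)).eval w σ = w.length + 1 := by simp [succE, Expr.eval, n1]
    rw [e1]
    refine Does.seq (does_squareCmd hW (by simpa using n1) (by simpa using n3) (by simp)
      (by simpa using n6) (by simpa using na) fun σ n1 n3 n5 n6 na => ?_)
    refine Does.seq (does_mulCmd hW n1 n3 n5 n6 na fun σ hσ => ?_)
    refine Does.seq (does_parseCmd hW hat hσ fun σ hσ => ?_)
    refine Does.seq (does_tableCmd hname hW hat hσ fun σ hσ => ?_)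
    refine Does.assign (e := .arr 3 (.const 0)) hW.letter_le ⟨Nat.zero_le _, ?_⟩ ?_
    · have v3 : ((3 : Fin 6) : ℕ) = 3 := rfl
      simp only [Expr.eval, v3]; omega
    · simp only [Expr.eval, State.setVar_var, if_true]
      refine ⟨hσ.der_le 0, ?_⟩
      rw [prime_iff_der]
      -- The whole formula begins at position `0`, and the triple of zeros has place `0`.
      exact hσ.der_iff 0 0 0 (.inr ⟨rfl, .inr ⟨rfl, le_rfl⟩⟩) φ φ φ (at_zero φ) (at_zero φ)
        (at_zero φ)
  · have hp := φ.size_pos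
    rw [hn]
    generalize φ.size = n at hp
    unfold square
    -- As `n ≥ 1`, the lower-order terms are absorbed into the cubic one; in terms of `k` this is a
    -- comparison of coefficients.
    obtain ⟨k, rfl⟩ : ∃ k, n = k + 1 := ⟨n - 1, by omega⟩
    ring_nf
    nlinarith [Nat.zero_le (k ^ 2), Nat.zero_le (k ^ 3)]

end Phases

/-! ### The decision procedure with its bounds -/

theorem decidesWithin_primeCmd {Act : Type*} {name : Act → ℕ} (hname : Function.Injective name)
    (φ : Formula Act) :
    DecidesWithin (primeCmd.code 0) (φ.code name) φ.Prime (100000 * φ.size ^ 3)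
      (100000 * (φ.size ^ 3 + (φ.code name).foldr max 0)) := by
  refine (does_primeCmd hname ⟨?_, fun a ha => ?_⟩).decidesWithin
  · rw [Formula.length_code]
    have hp := φ.size_pos
    generalize φ.size = n at hp
    unfold cube square
    obtain ⟨k, rfl⟩ : ∃ k, n = k + 1 := ⟨n - 1, by omega⟩
    ring_nf
    nlinarith [Nat.zero_le (k ^ 2), Nat.zero_le (k ^ 3)]
  · have : a ≤ (φ.code name).foldr max 0 := by
      generalize φ.code name = w at ha
      induction w with
      | nil => simp at ha
      | cons b w ih =>
        rcases List.mem_cons.1 ha with rfl | ha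
        · exact le_max_left _ _
        · exact (ih ha).trans (le_max_right _ _)
    omega

end Program

end SimLogic

theorem mainTheorem4 :
    (∃ (P : RAM.Program) (c : ℕ), ∀ (Act : Type*) [Finite Act] [Nonempty Act]
      (name : Act → ℕ), Function.Injective name → ∀ φ : SimLogic.Formula Act,
        RAM.DecidesWithin P (φ.code name) φ.Prime (c * φ.size ^ 3)
          (c * (φ.size ^ 3 + (φ.code name).foldr max 0))) ∧
    (∀ (Act : Type*) [Finite Act] [Nonempty Act] (φ : SimLogic.Formula Act),
      φ.Prime ↔ ∀ α ∈ φ.dnf, ∀ β ∈ φ.dnf, ∃ γ ∈ φ.dnf, α.Entails γ ∧ β.Entails γ) :=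
  ⟨⟨SimLogic.Program.primeCmd.code 0, 100000, fun _ _ _ _ hname φ =>
    SimLogic.Program.decidesWithin_primeCmd hname φ⟩,
    fun _ _ _ _ => SimLogic.Formula.prime_iff_directed⟩
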